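/- Let $\kappa\ge 2$, let $\Sigma=\{1,\dots,\kappa\}^{\mathbb N}$ with left shift $\sigma$ and the ultrametric in which two distinct words have distance $2^{-n}$, $n$ being the first place at which they differ, and let $\Gamma\subset\Sigma$ be compact with $\sigma(\Gamma)\subset\Gamma$. Write $\mathtt i|_n$ for the prefix of length $n$ of $\mathtt i\in\Sigma$, $[\mathtt w]$ for the cylinder of all $\mathtt i\in\Sigma$ that begin with the finite word $\mathtt w$, and $\Gamma_n=\{\mathtt i|_n:\mathtt i\in\Gamma\}$. A miniset of $A\subset\Gamma$ is a set $\sigma^{|\mathtt w|}(A\cap[\mathtt w])$ with $\mathtt w$ a finite word; a microset of $A$ is a compact subset of $\Gamma$ that is the limit of a sequence of minisets of $A$ in the Hausdorff metric. Put $$N_n(A)=\max\bigl\{\#\{\mathtt w\in\Gamma_n: A'\cap[\mathtt w]\neq\emptyset\}: A'\text{ is a microset of }A\bigr\}.$$ Let $\mathcal P(\Gamma)$ be the space of Borel probability measures on $\Gamma$ with the weak topology, and $\mathcal P_\Gamma=\mathcal P(\Gamma)\times\Gamma$. For $\mu\in\mathcal P(\Gamma)$ and a finite word $\mathtt w$ with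 $\mu([\mathtt w])>0$ let $\mu_{\mathtt w}\in\mathcal P(\Gamma)$ be given by $\mu_{\mathtt w}([\mathtt v])=\mu([\mathtt w\mathtt v])/\mu([\mathtt w])$ for all finite words $\mathtt v$; if $\mu([\mathtt w])=0$, put $\mu_{\mathtt w}=\mu$ (this choice is immaterial below). Let $M(\mu,\mathtt i)=(\mu_{\mathtt i|_1},\sigma(\mathtt i))$. A Borel probability measure $Q$ on $\mathcal P_\Gamma$ is adapted if there is a Borel probability measure $\overline Q$ on $\mathcal P(\Gamma)$ with $\int f\,dQ=\int\int f(\mu,\mathtt i)\,d\mu(\mathtt i)\,d\overline Q(\mu)$ for all continuous $f:\mathcal P_\Gamma\to\mathbb R$. A CP-distribution is an adapted $Q$ that is invariant under $M$; it is ergodic if every $M$-invariant Borel set has $Q$-measure $0$ or $1$. The information function is $I(\mu,\mathtt i)=-\log\mu([\mathtt i|_1])$ if $\mathtt i\in\operatorname{spt}\mu$ and $I(\mu,\mathtt i)=0$ otherwise. A measure $\mu\in\mathcal P(\Gamma)$ has entropy $h(\mu)=h\in\mathbb R$ if $-\frac1n\log\mu([\mathtt i|_n])\to h$ for $\mu$-almost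 every $\mathtt i$. Let $A\subset\Gamma$ be compact and non-empty. Then the limit $L=\lim_{n\to\infty}\frac1n\log N_n(A)$ exists in $\mathbb R$, and: (1) There is a CP-distribution $Q$ on $\mathcal P_\Gamma$ such that for $Q$-almost every $(\mu,\mathtt i)$ we have $\mathtt i\in\operatorname{spt}\mu$ and $\operatorname{spt}\mu$ is contained in a microset of $A$, and such that $I$ is $Q$-integrable with $$\int_{\mathcal P_\Gamma} I\,dQ=L.$$ (2) There is an ergodic CP-distribution $Q$ on $\mathcal P_\Gamma$ such that for $\overline Q$-almost every $\mu$ the support of $\mu$ is contained in a microset of $A$, the entropy $h(\mu)$ exists, and $L\le h(\mu)$. -/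

import Mathlib

open Set Filter Topology MeasureTheory
open scoped ENNReal NNReal

noncomputable section

namespace CPDist

/-- The shift space `Σ` of infinite words over an alphabet with `κ` letters, with the product
topology and the product (= Borel) `σ`-algebra. -/
abbrev Shift (κ : ℕ) : Type := ℕ → Fin κ

/-- Finite words. -/
abbrev Word (κ : ℕ) : Type := List (Fin κ)

variable {κ : ℕ}

/-- The left shift `σ`. -/
def shift (x : Shift κ) : Shift κ := fun n => x (n + 1)

/-- The prefix `x|_n`, a word of length `n`. -/
def pref (x : Shift κ) (n : ℕ) : Word κ := List.ofFn fun k : Fin n => x k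

/-- The cylinder `[w]`: the infinite words that start with `w`. -/
def cyl (w : Word κ) : Set (Shift κ) := {x | pref x w.length = w}

/-- `Γ_n`, the set of length `n` prefixes of elements of `Γ`. -/
def prefixes (Γ : Set (Shift κ)) (n : ℕ) : Set (Word κ) := (fun x => pref x n) '' Γ

/-- The Hausdorff distance of subsets of `Σ`, with respect to the ultrametric in which two words
have distance `2⁻ⁿ`, where `n` is the first place at which they differ. (Places are counted from
`0` here; counting from `1` multiplies all distances by `1/2`.) It is extended-valued: the distance
between the empty set and a nonempty set is `∞`. -/
def hausdorff (S T : Set (Shift κ)) : ℝ≥0∞ :=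
  letI : MetricSpace (Shift κ) := PiNat.metricSpace
  Metric.hausdorffEDist S T

/-- The magnification `β_w(A) = σ^{|w|}(A ∩ [w])`. -/
def beta (w : Word κ) (A : Set (Shift κ)) : Set (Shift κ) := shift^[w.length] '' (A ∩ cyl w)

/-- `A'` is a miniset of `A`. -/
def IsMiniset (A A' : Set (Shift κ)) : Prop := ∃ w : Word κ, A' = beta w A

/-- `A'` is a microset of `A`: a compact subset of `Γ` that is the limit, in the Hausdorff metric,
of a sequence of minisets of `A`. -/
def IsMicroset (Γ A A' : Set (Shift κ)) : Prop :=
  IsCompact A' ∧ A' ⊆ Γ ∧ ∃ B : ℕ → Set (Shift κ), (∀ n, IsMiniset A (B n)) ∧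
    Tendsto (fun n => hausdorff (B n) A') atTop (𝓝 0)

/-- The number of words `w ∈ Γ_n` whose cylinder meets `A'`. -/
def count (Γ A' : Set (Shift κ)) (n : ℕ) : ℕ :=
  {w ∈ prefixes Γ n | (A' ∩ cyl w).Nonempty}.ncard

/-- `N_n(A)`: the maximum of `count Γ A' n` over the microsets `A'` of `A`
(a bounded set of natural numbers, since there are at most `κ ^ n` words of length `n`). -/
def maxCount (Γ A : Set (Shift κ)) (n : ℕ) : ℕ :=
  sSup {c | ∃ A', IsMicroset Γ A A' ∧ c = count Γ A' n}

/-- `P(Γ)`: the Borel probability measures on `Γ`, with the weak topology and its Borel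
`σ`-algebra (see `borelSpace_prob`). -/
abbrev Prob (Γ : Set (Shift κ)) : Type := ProbabilityMeasure Γ

/-- The space `P(Γ) × Γ`. -/
abbrev ProbPt (Γ : Set (Shift κ)) : Type := Prob Γ × Γ

/-- The support of `μ ∈ P(Γ)`, as a subset of `Σ`. -/
def spt {Γ : Set (Shift κ)} (μ : Prob Γ) : Set (Shift κ) :=
  Subtype.val '' (μ : Measure Γ).support

/-- The trace on `Γ` of the cylinder `[w]`. -/
def cylIn (Γ : Set (Shift κ)) (w : Word κ) : Set Γ := Subtype.val ⁻¹' cyl w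

/-- The shift as a map `Γ → Γ`. -/
def shiftIn {Γ : Set (Shift κ)} (hσ : MapsTo shift Γ Γ) : Γ → Γ := hσ.restrict shift Γ Γ

theorem continuous_shift : Continuous (shift : Shift κ → Shift κ) := by
  unfold shift; fun_prop

theorem continuous_shiftIn {Γ : Set (Shift κ)} (hσ : MapsTo shift Γ Γ) :
    Continuous (shiftIn hσ) :=
  (continuous_shift.comp continuous_subtype_val).subtype_mk _

/-- The image under `σ^{|w|}` of `μ` conditioned on `[w]`, where `μ([w]) > 0`. -/
def condPos {Γ : Set (Shift κ)} (hσ : MapsTo shift Γ Γ) (μ : Prob Γ) (w : Word κ)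
    (h : (μ : Measure Γ) (cylIn Γ w) ≠ 0) : Prob Γ :=
  ⟨(ProbabilityTheory.cond (μ : Measure Γ) (cylIn Γ w)).map (shiftIn hσ)^[w.length],
    haveI := ProbabilityTheory.cond_isProbabilityMeasure h
    Measure.isProbabilityMeasure_map
      ((continuous_shiftIn hσ).iterate w.length).measurable.aemeasurable⟩

open Classical in
/-- The measure `μ_w`, with `μ_w([v]) = μ([wv]) / μ([w])` for all words `v` (see `condWord_cyl`).
If `μ([w]) = 0`, we put `μ_w = μ`; this affects `cpMap` only off the set `omega Γ`, which has full
measure for every adapted distribution. -/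
def condWord {Γ : Set (Shift κ)} (hσ : MapsTo shift Γ Γ) (μ : Prob Γ) (w : Word κ) : Prob Γ :=
  if h : (μ : Measure Γ) (cylIn Γ w) = 0 then μ else condPos hσ μ w h

/-- The map `M(μ, x) = (μ_{x|_1}, σ(x))`. -/
def cpMap {Γ : Set (Shift κ)} (hσ : MapsTo shift Γ Γ) (p : ProbPt Γ) : ProbPt Γ :=
  (condWord hσ p.1 (pref p.2.1 1), shiftIn hσ p.2)

/-- `Q` is adapted, with `Qb` the distribution on `P(Γ)` that witnesses this. -/
def IsAdaptedTo {Γ : Set (Shift κ)} (Q : ProbabilityMeasure (ProbPt Γ))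
    (Qb : ProbabilityMeasure (Prob Γ)) : Prop :=
  ∀ f : C(ProbPt Γ, ℝ),
    ∫ p, f p ∂(Q : Measure (ProbPt Γ)) =
      ∫ μ, ∫ x, f (μ, x) ∂(μ : Measure Γ) ∂(Qb : Measure (Prob Γ))

/-- `Q` is a CP-distribution: it is invariant under `M` and adapted. -/
def IsCP {Γ : Set (Shift κ)} (hσ : MapsTo shift Γ Γ) (Q : ProbabilityMeasure (ProbPt Γ)) : Prop :=
  MeasurePreserving (cpMap hσ) (Q : Measure (ProbPt Γ)) (Q : Measure (ProbPt Γ)) ∧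
    ∃ Qb : ProbabilityMeasure (Prob Γ), IsAdaptedTo Q Qb

/-- `Ω_Γ`. -/
def omega (Γ : Set (Shift κ)) : Set (ProbPt Γ) := {p | p.2.1 ∈ spt p.1}

/-- `Ω_Γ(A)`. -/
def omegaMicro (Γ A : Set (Shift κ)) : Set (ProbPt Γ) :=
  {p ∈ omega Γ | ∃ A', IsMicroset Γ A A' ∧ spt p.1 ⊆ A'}

open Classical in
/-- The information function: `-log μ([x|_1])` on `Ω_Γ`, and `0` elsewhere. -/
def info {Γ : Set (Shift κ)} (p : ProbPt Γ) : ℝ :=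
  if p ∈ omega Γ then -Real.log ((p.1 : Measure Γ).real (cylIn Γ (pref p.2.1 1))) else 0

/-- `μ` has an entropy, and it is `h`: `-(1/n) log μ([x|_n]) → h` for `μ`-almost every `x`. -/
def HasEntropy {Γ : Set (Shift κ)} (μ : Prob Γ) (h : ℝ) : Prop :=
  ∀ᵐ x ∂(μ : Measure Γ), Tendsto
    (fun n : ℕ => -(1 / (n : ℝ)) * Real.log ((μ : Measure Γ).real (cylIn Γ (pref x.1 n))))
    atTop (𝓝 h)

theorem isClopen_cyl (w : Word κ) : IsClopen (cyl w) := by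
  have h : Continuous fun x : Shift κ => fun k : Fin w.length => x k := by fun_prop
  have e : cyl w = (fun x : Shift κ => fun k : Fin w.length => x k) ⁻¹'
      {v | List.ofFn v = w} := rfl
  rw [e]
  exact (isClopen_discrete _).preimage h

theorem measurableSet_cylIn (Γ : Set (Shift κ)) (w : Word κ) : MeasurableSet (cylIn Γ w) :=
  ((isClopen_cyl w).preimage continuous_subtype_val).isOpen.measurableSet

theorem pref_take (x : Shift κ) {m n : ℕ} (h : m ≤ n) : (pref x n).take m = pref x m := by
  apply List.ext_getElem <;> simp [pref, h]

theorem shift_iterate (m k : ℕ) (x : Shift κ) : shift^[m] x k = x (m + k) := by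
  induction m generalizing k with
  | zero => simp
  | succ m ih =>
    rw [Function.iterate_succ_apply', shift, ih]
    congr 1; omega

theorem mem_cyl_append (w v : Word κ) (x : Shift κ) :
    x ∈ cyl (w ++ v) ↔ x ∈ cyl w ∧ shift^[w.length] x ∈ cyl v := by
  have e : pref x (w.length + v.length) =
      pref x w.length ++ pref (shift^[w.length] x) v.length := by
    simp only [pref, shift_iterate]
    rw [List.ofFn_add]
    rfl
  change pref x (w ++ v).length = _ ↔ pref x w.length = w ∧ pref _ v.length = v
  rw [List.length_append, e]
  constructor
  · intro h
    exact List.append_inj h (by simp [pref])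
  · rintro ⟨h1, h2⟩
    rw [h1, h2]

theorem condWord_cyl {Γ : Set (Shift κ)} (hσ : MapsTo shift Γ Γ) (μ : Prob Γ) (w v : Word κ)
    (hw : (μ : Measure Γ) (cylIn Γ w) ≠ 0) :
    (condWord hσ μ w : Measure Γ) (cylIn Γ v) =
      (μ : Measure Γ) (cylIn Γ (w ++ v)) / (μ : Measure Γ) (cylIn Γ w) := by
  have hit : ∀ (m : ℕ) (x : Γ), ((shiftIn hσ)^[m] x).1 = shift^[m] x.1 := by
    intro m
    induction m with
    | zero => simp
    | succ m ih =>
      intro x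
      rw [Function.iterate_succ_apply', Function.iterate_succ_apply', ← ih]
      rfl
  rw [condWord, dif_neg hw]
  change (Measure.map (shiftIn hσ)^[w.length]
    (ProbabilityTheory.cond (μ : Measure Γ) (cylIn Γ w))) _ = _
  rw [Measure.map_apply ((continuous_shiftIn hσ).iterate w.length).measurable
      (measurableSet_cylIn Γ v),
    ProbabilityTheory.cond_apply (measurableSet_cylIn Γ w), ENNReal.div_eq_inv_mul]
  congr 2
  ext x
  simp [cylIn, mem_cyl_append, hit]

theorem generateFrom_cylIn (Γ : Set (Shift κ)) :
    (inferInstance : MeasurableSpace Γ) = MeasurableSpace.generateFrom (range (cylIn Γ)) := by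
  apply le_antisymm
  · have hb := (PiNat.isTopologicalBasis_cylinders (E := fun _ => Fin κ)).isInducing
      (Topology.IsInducing.subtypeVal (t := Γ))
    rw [show (inferInstance : MeasurableSpace Γ) = borel Γ from BorelSpace.measurable_eq,
      hb.borel_eq_generateFrom]
    apply MeasurableSpace.generateFrom_mono
    rintro _ ⟨_, ⟨x, n, rfl⟩, rfl⟩
    refine ⟨pref x n, ?_⟩
    ext y
    simp only [cylIn, cyl, mem_preimage, PiNat.mem_cylinder_iff]
    change pref y.1 (pref x n).length = pref x n ↔ _
    simp only [pref, List.length_ofFn]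
    rw [List.ofFn_inj, funext_iff, Fin.forall_iff]
    rfl
  · apply MeasurableSpace.generateFrom_le
    rintro _ ⟨w, rfl⟩
    exact measurableSet_cylIn Γ w

theorem isPiSystem_cylIn (Γ : Set (Shift κ)) : IsPiSystem (range (cylIn Γ)) := by
  have key : ∀ (w v : Word κ) (x : Shift κ), x ∈ cyl w → x ∈ cyl v → w.length ≤ v.length →
      cyl v ⊆ cyl w := by
    intro w v x hw hv hl y hy
    change pref y w.length = w
    rw [← pref_take y hl, show pref y v.length = v from hy, ← show pref x v.length = v from hv,
      pref_take x hl]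
    exact hw
  rintro _ ⟨w, rfl⟩ _ ⟨v, rfl⟩ ⟨x, hw, hv⟩
  rcases le_total w.length v.length with h | h
  · exact ⟨v, (inter_eq_right.2 (preimage_mono (key w v x hw hv h))).symm⟩
  · exact ⟨w, (inter_eq_left.2 (preimage_mono (key v w x hv hw h))).symm⟩

theorem borelSpace_prob {Γ : Set (Shift κ)} (hΓ : IsCompact Γ) : BorelSpace (Prob Γ) := by
  have : CompactSpace Γ := isCompact_iff_compactSpace.1 hΓ
  let Φ : Prob Γ → Word κ → ℝ≥0 := fun μ w => μ (cylIn Γ w)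
  have hc : Continuous Φ := continuous_pi fun w => continuous_iff_continuousAt.2 fun μ =>
    ProbabilityMeasure.tendsto_measure_of_isClopen_of_tendsto tendsto_id
      ((isClopen_cyl w).preimage continuous_subtype_val)
  have hi : Function.Injective Φ := by
    intro μ ν h
    suffices this : (μ : Measure Γ) = (ν : Measure Γ) by
      exact Subtype.ext this
    refine ext_of_generate_finite _ (generateFrom_cylIn Γ) (isPiSystem_cylIn Γ) ?_ (by simp)
    rintro _ ⟨w, rfl⟩
    have := congrArg (fun r : ℝ≥0 => (r : ℝ≥0∞)) (congrFun h w)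
    simpa [Φ] using this
  refine ⟨le_antisymm ?_ ?_⟩
  · have hm : @Measurable _ _ (borel (Prob Γ)) _ (fun μ : Prob Γ => (μ : Measure Γ)) := by
      let _ : MeasurableSpace (ProbabilityMeasure Γ) := borel (Prob Γ)
      have : BorelSpace (ProbabilityMeasure Γ) := ⟨rfl⟩
      refine Measurable.measure_of_isPiSystem_of_isProbabilityMeasure
        (generateFrom_cylIn Γ) (isPiSystem_cylIn Γ) ?_
      rintro _ ⟨w, rfl⟩
      have := ((continuous_apply w).comp hc).measurable.coe_nnreal_ennreal
      simpa [Φ, Function.comp_def] using this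
    exact hm.comap_le
  · rw [(hc.isClosedEmbedding hi).eq_induced, borel_comap,
      ← BorelSpace.measurable_eq (α := Word κ → ℝ≥0)]
    refine Measurable.comap_le (measurable_pi_iff.2 fun w => ?_)
    exact ((Measure.measurable_coe (measurableSet_cylIn Γ w)).comp
      measurable_subtype_coe).ennreal_toNNReal

end CPDist

end

open CPDist

/-! The numbers N_n(A) are submultiplicative, so Fekete's lemma gives L. Hausdorff-close sets have
the same n-prefixes (`eventually_prefixes_eq`), so N_n(A) is attained by a miniset. Put equal atoms
in the n-cylinders which that miniset meets, one in each. The resulting measure μ_n has n-level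
entropy exactly log N_n(A).

Consider the Markov chain on P(Γ) that moves from μ to μ_a with probability μ([a]). It acts on
distributions by `step`, and `lift` turns its stationary distributions into CP-distributions
(`lift_step`). Information telescopes along orbits of M (`birkhoffSum_info`). Hence the mean of
`entropyOne` over the first n steps of the chain from μ_n is (1/n) log N_n(A). The chain is Feller
(`continuous_transition`), so a weak limit of these time averages is stationary, and since
`entropyOne` is continuous its integral is L. The supports are controlled by `microProb`, a closed
set that is preserved under conditioning and whose members live on microsets. This is (1).

For (2), the stationary distributions carried by `microProb` form a compact set. A maximiser of the
integral of `entropyOne` can be chosen there that is not a proper convex combination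
(`exists_extreme_maximizer`), and the maximum is at least L. Such a maximiser has an ergodic lift:
an M-invariant set has trivial fibres over almost every μ (`ae_section_null_or_conull`), so it
depends on μ only, and conditioning on it would split the maximiser. Birkhoff's theorem for `info`
then says that almost every μ has entropy equal to the maximum. -/

noncomputable section

namespace CPDist

/-! ### Birkhoff's ergodic theorem, by the maximal function -/

section Birkhoff

variable {α : Type*} {T : α → α} {f : α → ℝ}

/-- The running maximum `max_{0 ≤ k ≤ n} S_k f` of the Birkhoff sums of `f`. -/
def birkhoffMax (T : α → α) (f : α → ℝ) : ℕ → α → ℝ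
  | 0 => fun _ => 0
  | n + 1 => fun x => max 0 (f x + birkhoffMax T f n (T x))

theorem birkhoffMax_nonneg (n : ℕ) (x : α) : 0 ≤ birkhoffMax T f n x := by
  cases n with
  | zero => exact le_rfl
  | succ n => exact le_max_left _ _

theorem birkhoffMax_le_succ (n : ℕ) (x : α) :
    birkhoffMax T f n x ≤ birkhoffMax T f (n + 1) x := by
  induction n generalizing x with
  | zero => exact birkhoffMax_nonneg 1 x
  | succ n ih => exact max_le_max le_rfl (by linarith [ih (T x)])

theorem birkhoffSum_le_birkhoffMax (n : ℕ) (x : α) :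
    birkhoffSum T f n x ≤ birkhoffMax T f n x := by
  induction n generalizing x with
  | zero => simp [birkhoffMax]
  | succ n ih =>
    rw [birkhoffSum_succ']
    exact le_trans (by linarith [ih (T x)]) (le_max_right _ _)

/-- The recursion M_{n+1}(x) = max(0, f(x) + M_n(Tx)) transfers bounds both ways. The set of bounded
orbits is thus strictly invariant, as the zero-one law needs. -/
theorem bddAbove_birkhoffMax_comp_iff (x : α) :
    BddAbove (range fun n => birkhoffMax T f n (T x)) ↔
      BddAbove (range fun n => birkhoffMax T f n x) := by
  constructor
  · rintro ⟨C, hC⟩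
    refine ⟨max 0 (f x + C), ?_⟩
    rintro _ ⟨n, rfl⟩
    have := birkhoffMax_le_succ (T := T) (f := f) n x
    refine this.trans (max_le_max le_rfl ?_)
    linarith [hC ⟨n, rfl⟩]
  · rintro ⟨C, hC⟩
    refine ⟨C - f x, ?_⟩
    rintro _ ⟨n, rfl⟩
    have h1 : birkhoffMax T f (n + 1) x ≤ C := hC ⟨n + 1, rfl⟩
    have h2 : f x + birkhoffMax T f n (T x) ≤ birkhoffMax T f (n + 1) x := le_max_right _ _
    simp only
    linarith

variable [MeasurableSpace α] {μ : Measure α}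

theorem measurable_birkhoffMax (hT : Measurable T) (hf : Measurable f) (n : ℕ) :
    Measurable (birkhoffMax T f n) := by
  induction n with
  | zero => exact measurable_const
  | succ n ih => exact measurable_const.max (hf.add (ih.comp hT))

theorem integrable_birkhoffMax [IsFiniteMeasure μ] (hT : MeasurePreserving T μ μ)
    (hi : Integrable f μ) (n : ℕ) : Integrable (birkhoffMax T f n) μ := by
  induction n with
  | zero => exact integrable_const _
  | succ n ih =>
    exact (integrable_const (0 : ℝ)).sup (hi.add (hT.integrable_comp_of_integrable ih))

/-- If `f` has negative integral, its Birkhoff sums are almost surely bounded above. -/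
theorem ae_bddAbove_birkhoffMax [IsProbabilityMeasure μ] (hT : Ergodic T μ) (hf : Measurable f)
    (hi : Integrable f μ) (hneg : ∫ x, f x ∂μ < 0) :
    ∀ᵐ x ∂μ, BddAbove (range fun n => birkhoffMax T f n x) := by
  have hmeas := measurable_birkhoffMax hT.measurable hf
  have hTp := hT.toMeasurePreserving
  have hB : MeasurableSet {x | BddAbove (range fun n => birkhoffMax T f n x)} :=
    measurableSet_bddAbove_range hmeas
  rcases hT.toPreErgodic.ae_mem_or_ae_notMem hB
    (by ext x; exact bddAbove_birkhoffMax_comp_iff x) with h | h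
  · exact h
  -- Otherwise M_n ∘ T increases to ∞ almost everywhere, so M_{n+1} - M_n ∘ T = max(-M_n ∘ T, f)
  -- tends to f, dominated by |f|. These differences have nonnegative integral, because M_n ≤
  -- M_{n+1} and T preserves μ. So ∫ f ≥ 0, a contradiction.
  exfalso
  have hint := integrable_birkhoffMax (f := f) hTp hi
  have hlim : Tendsto (fun n => ∫ x, max (-birkhoffMax T f n (T x)) (f x) ∂μ) atTop
      (𝓝 (∫ x, f x ∂μ)) := by
    refine tendsto_integral_of_dominated_convergence (fun x => |f x|) (fun n => ?_) hi.abs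
      (fun n => ?_) ?_
    · exact (((hmeas n).comp hT.measurable).neg.max hf).aestronglyMeasurable
    · refine Eventually.of_forall fun x => ?_
      have := birkhoffMax_nonneg (T := T) (f := f) n (T x)
      rw [Real.norm_eq_abs, abs_le]
      exact ⟨(neg_abs_le (f x)).trans (le_max_right _ _),
        max_le (by linarith [abs_nonneg (f x)]) (le_abs_self _)⟩
    · filter_upwards [h] with x hx
      have hx' : ¬ BddAbove (range fun n => birkhoffMax T f n (T x)) := by
        rwa [bddAbove_birkhoffMax_comp_iff]
      have hmono : Monotone fun n => birkhoffMax T f n (T x) :=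
        monotone_nat_of_le_succ fun n => birkhoffMax_le_succ n (T x)
      have htop := (tendsto_atTop_atTop_of_monotone' hmono hx').eventually_ge_atTop (-f x)
      refine tendsto_const_nhds.congr' ?_
      filter_upwards [htop] with n hn
      rw [max_eq_right]
      linarith
  have hge : ∀ n, 0 ≤ ∫ x, max (-birkhoffMax T f n (T x)) (f x) ∂μ := by
    intro n
    have e : ∀ x, max (-birkhoffMax T f n (T x)) (f x) =
        birkhoffMax T f (n + 1) x - birkhoffMax T f n (T x) := by
      intro x
      change _ = max 0 (f x + birkhoffMax T f n (T x)) - _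
      rw [← max_sub_sub_right]
      congr 1 <;> ring
    simp_rw [e]
    have hc : Integrable (fun x => birkhoffMax T f n (T x)) μ :=
      hTp.integrable_comp_of_integrable (hint n)
    rw [integral_sub (hint _) hc]
    have e2 : ∫ x, birkhoffMax T f n (T x) ∂μ = ∫ x, birkhoffMax T f n x ∂μ := by
      conv_rhs => rw [← hTp.map_eq]
      rw [integral_map hT.measurable.aemeasurable (hmeas n).aestronglyMeasurable]
    rw [e2, sub_nonneg]
    exact integral_mono (hint _) (hint _) fun x => birkhoffMax_le_succ n x
  exact absurd (ge_of_tendsto' hlim hge) (not_le.2 hneg)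

/-- For d strictly between the mean and c, the sums of f - d are bounded above by some C, so the
averages of f are at most d + C/n. -/
theorem ae_eventually_birkhoffSum_lt [IsProbabilityMeasure μ] (hT : Ergodic T μ)
    (hf : Measurable f) (hi : Integrable f μ) {c : ℝ} (hc : ∫ x, f x ∂μ < c) :
    ∀ᵐ x ∂μ, ∀ᶠ n : ℕ in atTop, 1 / (n : ℝ) * birkhoffSum T f n x < c := by
  obtain ⟨d, hd, hdc⟩ := exists_between hc
  have hneg : ∫ x, (f x - d) ∂μ < 0 := by
    rw [integral_sub hi (integrable_const _)]
    simpa using hd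
  filter_upwards [ae_bddAbove_birkhoffMax hT (hf.sub_const d) (hi.sub (integrable_const d)) hneg]
    with x ⟨C, hC⟩
  have hlim : Tendsto (fun n : ℕ => d + C / n) atTop (𝓝 (d + 0)) :=
    tendsto_const_nhds.add (tendsto_const_div_atTop_nhds_zero_nat C)
  rw [add_zero] at hlim
  filter_upwards [hlim.eventually_lt_const hdc, eventually_gt_atTop 0] with n hn hn0
  refine lt_of_le_of_lt ?_ hn
  have h1 := (birkhoffSum_le_birkhoffMax (T := T) (f := fun x => f x - d) n x).trans (hC ⟨n, rfl⟩)
  have h2 : birkhoffSum T (fun x => f x - d) n x = birkhoffSum T f n x - n * d := by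
    simp [birkhoffSum, Finset.sum_sub_distrib]
  have hn' : (0 : ℝ) < n := by exact_mod_cast hn0
  rw [h2] at h1
  rw [one_div, inv_mul_eq_div, div_le_iff₀ hn', add_mul, div_mul_cancel₀ _ hn'.ne']
  linarith

/-- **Birkhoff's pointwise ergodic theorem** for ergodic transformations. -/
theorem tendsto_birkhoffSum_of_ergodic [IsProbabilityMeasure μ] (hT : Ergodic T μ)
    (hf : Measurable f) (hi : Integrable f μ) :
    ∀ᵐ x ∂μ, Tendsto (fun n : ℕ => 1 / (n : ℝ) * birkhoffSum T f n x) atTop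
      (𝓝 (∫ x, f x ∂μ)) := by
  have hup : ∀ j : ℕ, ∀ᵐ x ∂μ, ∀ᶠ n : ℕ in atTop,
      1 / (n : ℝ) * birkhoffSum T f n x < ∫ x, f x ∂μ + 1 / ((j : ℝ) + 1) := fun j =>
    ae_eventually_birkhoffSum_lt hT hf hi (by
      have : (0 : ℝ) < 1 / ((j : ℝ) + 1) := Nat.one_div_pos_of_nat
      linarith)
  have hlo : ∀ j : ℕ, ∀ᵐ x ∂μ, ∀ᶠ n : ℕ in atTop,
      1 / (n : ℝ) * birkhoffSum T (-f) n x < -∫ x, f x ∂μ + 1 / ((j : ℝ) + 1) := fun j =>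
    ae_eventually_birkhoffSum_lt hT hf.neg hi.neg (by
      have : (0 : ℝ) < 1 / ((j : ℝ) + 1) := Nat.one_div_pos_of_nat
      have e : ∫ x, (-f) x ∂μ = -∫ x, f x ∂μ := integral_neg f
      rw [e]
      linarith)
  filter_upwards [ae_all_iff.2 hup, ae_all_iff.2 hlo] with x h1 h2
  rw [Metric.tendsto_nhds]
  intro ε hε
  obtain ⟨j, hj⟩ := exists_nat_one_div_lt hε
  filter_upwards [h1 j, h2 j] with n a b
  have e : birkhoffSum T (-f) n x = -birkhoffSum T f n x := by simp [birkhoffSum]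
  rw [e] at b
  rw [Real.dist_eq, abs_lt]
  constructor <;> linarith

end Birkhoff

/-! ### Prefixes, minisets, and the growth rate of N_n -/

section Words

variable {κ : ℕ} {Γ A B C : Set (Shift κ)}

@[simp]
theorem length_pref (x : Shift κ) (n : ℕ) : (pref x n).length = n := by simp [pref]

theorem pref_eq_pref_iff {x y : Shift κ} {n : ℕ} : pref x n = pref y n ↔ ∀ i < n, x i = y i := by
  rw [pref, pref, List.ofFn_inj, funext_iff, Fin.forall_iff]

theorem mem_cyl_pref {x y : Shift κ} {n : ℕ} : y ∈ cyl (pref x n) ↔ pref y n = pref x n := by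
  change pref y (pref x n).length = pref x n ↔ _
  rw [length_pref]

theorem self_mem_cyl_pref (x : Shift κ) (n : ℕ) : x ∈ cyl (pref x n) := mem_cyl_pref.2 rfl

theorem cyl_pref_anti (x : Shift κ) {m n : ℕ} (h : m ≤ n) : cyl (pref x n) ⊆ cyl (pref x m) := by
  intro y hy
  rw [mem_cyl_pref] at hy ⊢
  rw [← pref_take y h, hy, pref_take x h]

theorem hasBasis_nhds_cyl (x : Shift κ) :
    (𝓝 x).HasBasis (fun _ : ℕ => True) fun n => cyl (pref x n) := by
  refine ⟨fun t => ⟨fun ht => ?_, fun ⟨n, _, hn⟩ =>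
    mem_of_superset ((isClopen_cyl _).isOpen.mem_nhds (self_mem_cyl_pref x n)) hn⟩⟩
  obtain ⟨_, ⟨y, n, rfl⟩, hxy, hyt⟩ :=
    (PiNat.isTopologicalBasis_cylinders (E := fun _ => Fin κ)).mem_nhds_iff.1 ht
  refine ⟨n, trivial, fun z hz => hyt ?_⟩
  rw [mem_cyl_pref, pref_eq_pref_iff] at hz
  exact fun i hi => (hz i hi).trans (hxy i hi)

theorem mem_of_forall_nonempty_inter_cyl (hB : IsClosed B) {x : Shift κ}
    (h : ∀ n, (B ∩ cyl (pref x n)).Nonempty) : x ∈ B := by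
  rw [← hB.closure_eq, mem_closure_iff_nhds_basis (hasBasis_nhds_cyl x)]
  intro n _
  obtain ⟨y, hy, hyn⟩ := h n
  exact ⟨y, hy, hyn⟩

theorem mem_prefixes_iff {n : ℕ} {v : Word κ} :
    v ∈ prefixes B n ↔ v.length = n ∧ (B ∩ cyl v).Nonempty := by
  constructor
  · rintro ⟨x, hx, rfl⟩
    exact ⟨length_pref x n, x, hx, self_mem_cyl_pref x n⟩
  · rintro ⟨rfl, x, hx, hv⟩
    exact ⟨x, hx, hv⟩

theorem finite_prefixes (B : Set (Shift κ)) (n : ℕ) : (prefixes B n).Finite :=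
  (List.finite_length_eq (Fin κ) n).subset fun _ hv => (mem_prefixes_iff.1 hv).1

theorem count_eq_ncard_prefixes (hB : B ⊆ Γ) (n : ℕ) : count Γ B n = (prefixes B n).ncard := by
  unfold count
  congr 1
  ext v
  simp only [mem_ofPred_eq, mem_prefixes_iff]
  constructor
  · rintro ⟨⟨h, -⟩, h'⟩
    exact ⟨h, h'⟩
  · rintro ⟨h, h'⟩
    exact ⟨⟨h, h'.mono (inter_subset_inter_left _ hB)⟩, h'⟩

theorem nonempty_beta_inter_cyl (w v : Word κ) :
    (beta w A ∩ cyl v).Nonempty ↔ (A ∩ cyl (w ++ v)).Nonempty := by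
  constructor
  · rintro ⟨_, ⟨x, ⟨hx, hw⟩, rfl⟩, hv⟩
    exact ⟨x, hx, (mem_cyl_append w v x).2 ⟨hw, hv⟩⟩
  · rintro ⟨x, hx, h⟩
    obtain ⟨hw, hv⟩ := (mem_cyl_append w v x).1 h
    exact ⟨_, ⟨x, ⟨hx, hw⟩, rfl⟩, hv⟩

theorem beta_subset (hσ : MapsTo shift Γ Γ) (hA : A ⊆ Γ) (w : Word κ) : beta w A ⊆ Γ := by
  rintro _ ⟨x, ⟨hx, -⟩, rfl⟩
  exact hσ.iterate _ (hA hx)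

theorem isCompact_beta (hA : IsCompact A) (w : Word κ) : IsCompact (beta w A) :=
  (hA.inter_right (isClopen_cyl w).isClosed).image (continuous_shift.iterate _)

theorem isMicroset_beta (hσ : MapsTo shift Γ Γ) (hAΓ : A ⊆ Γ) (hA : IsCompact A) (w : Word κ) :
    IsMicroset Γ A (beta w A) := by
  refine ⟨isCompact_beta hA w, beta_subset hσ hAΓ w, fun _ => beta w A, fun _ => ⟨w, rfl⟩, ?_⟩
  have : hausdorff (beta w A) (beta w A) = 0 := by
    let _ : MetricSpace (Shift κ) := PiNat.metricSpace
    exact Metric.hausdorffEDist_self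
  simp [this]

theorem hausdorff_comm (B C : Set (Shift κ)) : hausdorff B C = hausdorff C B := by
  let _ : MetricSpace (Shift κ) := PiNat.metricSpace
  exact Metric.hausdorffEDist_comm

/-- Points at distance less than 2⁻ⁿ agree in their first n letters. Hausdorff limits are therefore
eventually exact at every fixed resolution. -/
theorem prefixes_subset_of_hausdorff_lt {n : ℕ}
    (h : hausdorff B C < ENNReal.ofReal ((1 / 2) ^ n)) : prefixes B n ⊆ prefixes C n := by
  let _ : MetricSpace (Shift κ) := PiNat.metricSpace
  rintro _ ⟨x, hx, rfl⟩
  obtain ⟨y, hy, hxy⟩ := Metric.exists_edist_lt_of_hausdorffEDist_lt hx h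
  refine ⟨y, hy, ?_⟩
  rw [edist_lt_ofReal] at hxy
  have h3 := PiNat.mem_cylinder_iff_dist_le.2 hxy.le
  change pref y n = pref x n
  exact pref_eq_pref_iff.2 fun i hi => (h3 i hi).symm

theorem prefixes_eq_of_hausdorff_lt {n : ℕ}
    (h : hausdorff B C < ENNReal.ofReal ((1 / 2) ^ n)) : prefixes B n = prefixes C n :=
  (prefixes_subset_of_hausdorff_lt h).antisymm
    (prefixes_subset_of_hausdorff_lt (hausdorff_comm B C ▸ h))

theorem eventually_prefixes_eq {B : ℕ → Set (Shift κ)}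
    (h : Tendsto (fun k => hausdorff (B k) C) atTop (𝓝 0)) (n : ℕ) :
    ∀ᶠ k in atTop, prefixes (B k) n = prefixes C n := by
  have : (0 : ℝ≥0∞) < ENNReal.ofReal ((1 / 2) ^ n) := ENNReal.ofReal_pos.2 (by positivity)
  filter_upwards [h.eventually_lt_const this] with k hk
  exact prefixes_eq_of_hausdorff_lt hk

/-- The hyperspace `Closeds α` is compact. It contains the empty set, so empty minisets need no
separate treatment. -/
theorem exists_tendsto_hausdorffEDist {α : Type*} [MetricSpace α] [CompactSpace α]
    {B : ℕ → Set α} (hc : ∀ n, IsCompact (B n)) :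
    ∃ C : Set α, IsCompact C ∧ ∃ φ : ℕ → ℕ, StrictMono φ ∧
      Tendsto (fun n => Metric.hausdorffEDist (B (φ n)) C) atTop (𝓝 0) := by
  obtain ⟨C, φ, hφ, h⟩ := CompactSpace.tendsto_subseq
    fun n => (⟨B n, (hc n).isClosed⟩ : TopologicalSpace.Closeds α)
  refine ⟨C, C.isClosed.isCompact, φ, hφ, ?_⟩
  have := tendsto_iff_edist_tendsto_0.1 h
  exact this

theorem exists_tendsto_hausdorff {B : ℕ → Set (Shift κ)} (hc : ∀ n, IsCompact (B n)) :
    ∃ C : Set (Shift κ), IsCompact C ∧ ∃ φ : ℕ → ℕ, StrictMono φ ∧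
      Tendsto (fun n => hausdorff (B (φ n)) C) atTop (𝓝 0) := by
  let _ : MetricSpace (Shift κ) := PiNat.metricSpace
  exact exists_tendsto_hausdorffEDist hc

theorem bddAbove_counts (Γ A : Set (Shift κ)) (n : ℕ) :
    BddAbove {c | ∃ A', IsMicroset Γ A A' ∧ c = count Γ A' n} := by
  refine ⟨(prefixes Γ n).ncard, ?_⟩
  rintro _ ⟨A', -, rfl⟩
  exact ncard_le_ncard (sep_subset _ _) (finite_prefixes Γ n)

theorem ncard_prefixes_beta_le (hσ : MapsTo shift Γ Γ) (hAΓ : A ⊆ Γ) (hA : IsCompact A)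
    (w : Word κ) (n : ℕ) : (prefixes (beta w A) n).ncard ≤ maxCount Γ A n :=
  le_csSup (bddAbove_counts Γ A n) ⟨beta w A, isMicroset_beta hσ hAΓ hA w,
    (count_eq_ncard_prefixes (beta_subset hσ hAΓ w) n).symm⟩

/-- The maximum is attained by a microset, and a miniset close enough to it has the same n-prefixes.
-/
theorem exists_ncard_prefixes_beta_eq (hσ : MapsTo shift Γ Γ) (hAΓ : A ⊆ Γ) (hA : IsCompact A)
    (n : ℕ) : ∃ w : Word κ, (prefixes (beta w A) n).ncard = maxCount Γ A n := by
  have hne : {c | ∃ A', IsMicroset Γ A A' ∧ c = count Γ A' n}.Nonempty :=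
    ⟨_, beta [] A, isMicroset_beta hσ hAΓ hA [], rfl⟩
  obtain ⟨A', ⟨-, hA', B, hB, hlim⟩, h⟩ := Nat.sSup_mem hne (bddAbove_counts Γ A n)
  obtain ⟨k, hk⟩ := (eventually_prefixes_eq hlim n).exists
  obtain ⟨w, hw⟩ := hB k
  refine ⟨w, ?_⟩
  rw [← hw, hk, ← count_eq_ncard_prefixes hA' n]
  exact h.symm

theorem one_le_maxCount (hσ : MapsTo shift Γ Γ) (hAΓ : A ⊆ Γ) (hA : IsCompact A)
    (hne : A.Nonempty) (n : ℕ) : 1 ≤ maxCount Γ A n := by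
  refine le_trans ?_ (ncard_prefixes_beta_le hσ hAΓ hA [] n)
  rw [Nat.one_le_iff_ne_zero, ne_eq, ncard_eq_zero (finite_prefixes _ _)]
  obtain ⟨x, hx⟩ := hne
  refine Nonempty.ne_empty ⟨pref x n, mem_prefixes_iff.2 ⟨length_pref x n, ?_⟩⟩
  rw [nonempty_beta_inter_cyl]
  exact ⟨x, hx, self_mem_cyl_pref x n⟩

/-- An (m+n)-prefix of an optimal miniset β_w(A) is an m-prefix u of β_w(A) followed by an n-prefix
of β_{wu}(A). There are at most N_m choices of u, and at most N_n continuations of each. -/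
theorem maxCount_add_le (hσ : MapsTo shift Γ Γ) (hAΓ : A ⊆ Γ) (hA : IsCompact A) (m n : ℕ) :
    maxCount Γ A (m + n) ≤ maxCount Γ A m * maxCount Γ A n := by
  classical
  obtain ⟨w, hw⟩ := exists_ncard_prefixes_beta_eq hσ hAΓ hA (m + n)
  have hf := finite_prefixes (beta w A) (m + n)
  rw [← hw, ncard_eq_toFinset_card _ hf]
  have himg : (hf.toFinset.image (List.take m)).card ≤ maxCount Γ A m := by
    refine le_trans ?_ (ncard_prefixes_beta_le hσ hAΓ hA w m)
    rw [ncard_eq_toFinset_card _ (finite_prefixes (beta w A) m)]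
    refine Finset.card_le_card fun u hu => ?_
    obtain ⟨v, hv, rfl⟩ := Finset.mem_image.1 hu
    obtain ⟨x, hx, rfl⟩ := hf.mem_toFinset.1 hv
    exact (finite_prefixes (beta w A) m).mem_toFinset.2
      ⟨x, hx, (pref_take x (Nat.le_add_right m n)).symm⟩
  refine (Finset.card_le_mul_card_image (f := List.take m) _ (maxCount Γ A n) ?_).trans ?_
  · intro u _
    refine le_trans ?_ (ncard_prefixes_beta_le hσ hAΓ hA (w ++ u) n)
    rw [ncard_eq_toFinset_card _ (finite_prefixes (beta (w ++ u) A) n)]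
    refine Finset.card_le_card_of_injOn (List.drop m) (fun v hv => ?_) fun v hv v' hv' e => ?_
    · obtain ⟨hv1, hv2⟩ := Finset.mem_filter.1 hv
      obtain ⟨hl, hv3⟩ := mem_prefixes_iff.1 (hf.mem_toFinset.1 hv1)
      refine (finite_prefixes _ n).mem_toFinset.2 (mem_prefixes_iff.2 ⟨by simp [hl], ?_⟩)
      rw [nonempty_beta_inter_cyl] at hv3 ⊢
      rwa [List.append_assoc, ← hv2, List.take_append_drop]
    · rw [← List.take_append_drop m v, ← List.take_append_drop m v',
        (Finset.mem_filter.1 hv).2, (Finset.mem_filter.1 hv').2]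
      exact congrArg _ e
  · rw [mul_comm]
    exact Nat.mul_le_mul_right _ himg

theorem exists_tendsto_log_maxCount (hσ : MapsTo shift Γ Γ) (hAΓ : A ⊆ Γ) (hA : IsCompact A)
    (hne : A.Nonempty) :
    ∃ L : ℝ, Tendsto (fun n : ℕ => 1 / (n : ℝ) * Real.log (maxCount Γ A n)) atTop (𝓝 L) := by
  have hpos : ∀ n, (1 : ℝ) ≤ maxCount Γ A n := fun n => by
    exact_mod_cast one_le_maxCount hσ hAΓ hA hne n
  have hsub : Subadditive fun n => Real.log (maxCount Γ A n) := by
    intro m n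
    rw [← Real.log_mul (by linarith [hpos m]) (by linarith [hpos n])]
    refine Real.log_le_log (by linarith [hpos (m + n)]) ?_
    exact_mod_cast maxCount_add_le hσ hAΓ hA m n
  refine ⟨hsub.lim, (hsub.tendsto_lim ⟨0, ?_⟩).congr fun n => by rw [one_div, inv_mul_eq_div]⟩
  rintro _ ⟨n, rfl⟩
  exact div_nonneg (Real.log_nonneg (hpos n)) (Nat.cast_nonneg n)

end Words

/-! ### The map M, the chain rule for information, and adapted lifts -/

section CPMap

variable {κ : ℕ} {Γ : Set (Shift κ)}

theorem pref_one (x : Shift κ) : pref x 1 = [x 0] := by simp [pref]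

theorem pref_add (x : Shift κ) (m n : ℕ) :
    pref x (m + n) = pref x m ++ pref (shift^[m] x) n := by
  simp only [pref, shift_iterate]
  rw [List.ofFn_add]
  rfl

theorem shiftIn_iterate (hσ : MapsTo shift Γ Γ) (n : ℕ) (x : Γ) :
    ((shiftIn hσ)^[n] x).1 = shift^[n] x.1 := by
  induction n with
  | zero => simp
  | succ n ih =>
    rw [Function.iterate_succ_apply', Function.iterate_succ_apply', ← ih]
    rfl

theorem measurable_comp_pref {β : Type*} [MeasurableSpace β] (f : Word κ → β) (n : ℕ) :
    Measurable fun x : Γ => f (pref x.1 n) := by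
  let _ : MeasurableSpace (Word κ) := ⊤
  have : Measurable fun x : Γ => pref x.1 n := by
    refine measurable_to_countable fun x => ?_
    convert! measurableSet_cylIn Γ (pref x.1 n)
    ext y
    exact (mem_cyl_pref).symm
  exact (measurable_from_top (f := f)).comp this

theorem measurable_condWord (hσ : MapsTo shift Γ Γ) (w : Word κ) :
    Measurable fun μ : Prob Γ => condWord hσ μ w := by
  have hc : ∀ v, Measurable fun μ : Prob Γ => (μ : Measure Γ) (cylIn Γ v) := fun v =>
    (Measure.measurable_coe (measurableSet_cylIn Γ v)).comp measurable_subtype_coe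
  suffices Measurable fun μ : Prob Γ => (condWord hσ μ w : Measure Γ) from
    Measurable.subtype_mk this
  refine Measurable.measure_of_isPiSystem_of_isProbabilityMeasure (generateFrom_cylIn Γ)
    (isPiSystem_cylIn Γ) ?_
  rintro _ ⟨v, rfl⟩
  have e : (fun μ : Prob Γ => (condWord hσ μ w : Measure Γ) (cylIn Γ v)) = fun μ : Prob Γ =>
      if (μ : Measure Γ) (cylIn Γ w) = 0 then (μ : Measure Γ) (cylIn Γ v) else
        (μ : Measure Γ) (cylIn Γ (w ++ v)) / (μ : Measure Γ) (cylIn Γ w) := by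
    ext μ
    split_ifs with h
    · rw [condWord, dif_pos h]
    · exact condWord_cyl hσ μ w v h
  rw [e]
  exact Measurable.ite (hc w (measurableSet_singleton 0)) (hc v) ((hc _).div (hc w))

/-- There are countably many words, so joint measurability reduces to one fixed word at a time. -/
theorem measurable_uncurry_pref {β : Type*} [MeasurableSpace β] {f : Prob Γ → Word κ → β}
    (hf : ∀ w, Measurable fun μ => f μ w) (n : ℕ) :
    Measurable fun p : ProbPt Γ => f p.1 (pref p.2.1 n) := by
  let _ : MeasurableSpace (Word κ) := ⊤
  have h1 : Measurable fun q : Prob Γ × Word κ => f q.1 q.2 :=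
    measurable_from_prod_countable_left hf
  exact h1.comp (measurable_fst.prodMk ((measurable_comp_pref id n).comp measurable_snd))

theorem measurable_cpMap (hσ : MapsTo shift Γ Γ) : Measurable (cpMap hσ) :=
  (measurable_uncurry_pref (measurable_condWord hσ) 1).prodMk
    ((continuous_shiftIn hσ).measurable.comp measurable_snd)

theorem prob_ext {μ ν : Prob Γ}
    (h : ∀ w, (μ : Measure Γ) (cylIn Γ w) = (ν : Measure Γ) (cylIn Γ w)) : μ = ν := by
  suffices this : (μ : Measure Γ) = (ν : Measure Γ) from Subtype.ext this
  refine ext_of_generate_finite _ (generateFrom_cylIn Γ) (isPiSystem_cylIn Γ) ?_ (by simp)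
  rintro _ ⟨w, rfl⟩
  exact h w

/-- The normalising factors μ([u]) cancel. Positive mass of [uv] keeps both conditionings away from
the default value. -/
theorem condWord_append (hσ : MapsTo shift Γ Γ) (μ : Prob Γ) (u v : Word κ)
    (h : (μ : Measure Γ) (cylIn Γ (u ++ v)) ≠ 0) :
    condWord hσ (condWord hσ μ u) v = condWord hσ μ (u ++ v) := by
  have hu : (μ : Measure Γ) (cylIn Γ u) ≠ 0 := fun h0 => h <| measure_mono_null
    (fun x hx => ((mem_cyl_append u v x.1).1 hx).1) h0
  have hv : (condWord hσ μ u : Measure Γ) (cylIn Γ v) ≠ 0 := by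
    rw [condWord_cyl hσ μ u v hu]
    exact ENNReal.div_ne_zero.2 ⟨h, measure_ne_top _ _⟩
  refine prob_ext fun w => ?_
  rw [condWord_cyl hσ _ v w hv, condWord_cyl hσ μ u _ hu, condWord_cyl hσ μ u _ hu,
    condWord_cyl hσ μ _ _ h, List.append_assoc]
  have h1 := ENNReal.inv_ne_zero.2 (measure_ne_top (μ : Measure Γ) (cylIn Γ u))
  have h2 := ENNReal.inv_ne_top.2 hu
  simp only [div_eq_mul_inv _ ((μ : Measure Γ) (cylIn Γ u))]
  rw [ENNReal.mul_div_mul_right _ _ h1 h2]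

theorem mem_omega_iff {p : ProbPt Γ} :
    p ∈ omega Γ ↔ ∀ n, (p.1 : Measure Γ) (cylIn Γ (pref p.2.1 n)) ≠ 0 := by
  have hb : (𝓝 p.2).HasBasis (fun _ : ℕ => True) fun n => cylIn Γ (pref p.2.1 n) := by
    rw [nhds_subtype_eq_comap]
    exact (hasBasis_nhds_cyl p.2.1).comap _
  change p.2.1 ∈ Subtype.val '' (p.1 : Measure Γ).support ↔ _
  rw [Subtype.val_injective.mem_set_image, hb.mem_measureSupport]
  simp [pos_iff_ne_zero]

theorem measurableSet_omega : MeasurableSet (omega Γ) := by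
  have : omega Γ = ⋂ n, {p : ProbPt Γ | (p.1 : Measure Γ) (cylIn Γ (pref p.2.1 n)) ≠ 0} := by
    ext p
    simp [mem_omega_iff]
  rw [this]
  refine MeasurableSet.iInter fun n => ?_
  have := measurable_uncurry_pref (f := fun (μ : Prob Γ) w => (μ : Measure Γ) (cylIn Γ w))
    (fun w => (Measure.measurable_coe (measurableSet_cylIn Γ w)).comp measurable_subtype_coe) n
  exact this (measurableSet_singleton 0).compl

theorem ae_mem_omega (μ : Prob Γ) : ∀ᵐ x ∂(μ : Measure Γ), (μ, x) ∈ omega Γ := by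
  filter_upwards [Measure.support_mem_ae (μ := (μ : Measure Γ))] with x hx
  exact ⟨x, hx, rfl⟩

theorem cpMap_iterate (hσ : MapsTo shift Γ Γ) {p : ProbPt Γ} (hp : p ∈ omega Γ) (n : ℕ) :
    (cpMap hσ)^[n] p = (condWord hσ p.1 (pref p.2.1 n), (shiftIn hσ)^[n] p.2) := by
  rw [mem_omega_iff] at hp
  induction n with
  | zero =>
    refine Prod.ext (prob_ext fun w => ?_) rfl
    have h0 : (p.1 : Measure Γ) (cylIn Γ []) = 1 := by
      have : cylIn Γ [] = univ := by ext x; simp [cylIn, cyl, pref]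
      rw [this, measure_univ]
    have : pref p.2.1 0 = [] := by simp [pref]
    simp only [this]
    rw [condWord_cyl hσ _ _ _ (by rw [h0]; exact one_ne_zero), h0]
    simp
  | succ n ih =>
    rw [Function.iterate_succ_apply', ih]
    refine Prod.ext ?_ (Function.iterate_succ_apply' (shiftIn hσ) n p.2).symm
    simp only [cpMap]
    rw [shiftIn_iterate, condWord_append, ← pref_add]
    rw [← pref_add]
    exact hp _

theorem cpMap_iterate_mem_omega (hσ : MapsTo shift Γ Γ) {p : ProbPt Γ} (hp : p ∈ omega Γ)
    (n : ℕ) : (cpMap hσ)^[n] p ∈ omega Γ := by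
  rw [cpMap_iterate hσ hp, mem_omega_iff]
  rw [mem_omega_iff] at hp
  intro k
  simp only
  rw [condWord_cyl hσ _ _ _ (hp n), shiftIn_iterate, ← pref_add]
  exact ENNReal.div_ne_zero.2 ⟨hp _, measure_ne_top _ _⟩

/-- The k-th term is -log of μ([x|_{k+1}]) / μ([x|_k]), so the sum telescopes. -/
theorem birkhoffSum_info (hσ : MapsTo shift Γ Γ) {p : ProbPt Γ} (hp : p ∈ omega Γ) (n : ℕ) :
    birkhoffSum (cpMap hσ) info n p =
      -Real.log ((p.1 : Measure Γ).real (cylIn Γ (pref p.2.1 n))) := by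
  have hp' := mem_omega_iff.1 hp
  induction n with
  | zero =>
    have : cylIn Γ (pref p.2.1 0) = univ := by ext x; simp [cylIn, cyl, pref]
    simp [this]
  | succ n ih =>
    rw [birkhoffSum_succ, ih, info, if_pos (cpMap_iterate_mem_omega hσ hp n), cpMap_iterate hσ hp]
    simp only [measureReal_def]
    rw [condWord_cyl hσ _ _ _ (hp' n), shiftIn_iterate, ← pref_add, ENNReal.toReal_div,
      Real.log_div]
    · ring
    · exact (ENNReal.toReal_pos (hp' _) (measure_ne_top _ _)).ne'
    · exact (ENNReal.toReal_pos (hp' _) (measure_ne_top _ _)).ne'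

/-- The tautological Markov kernel from `P(Γ)` to `Γ`. -/
def ker (Γ : Set (Shift κ)) : ProbabilityTheory.Kernel (Prob Γ) Γ :=
  ⟨fun μ => (μ : Measure Γ), measurable_subtype_coe⟩

theorem ker_apply (μ : Prob Γ) : ker Γ μ = (μ : Measure Γ) := rfl

instance : ProbabilityTheory.IsMarkovKernel (ker Γ) :=
  ⟨fun μ => by rw [ker_apply]; infer_instance⟩

/-- The adapted distribution `∫ δ_μ × μ dQ(μ)`. -/
def lift (Q : ProbabilityMeasure (Prob Γ)) : ProbabilityMeasure (ProbPt Γ) :=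
  ⟨(Q : Measure (Prob Γ)).compProd (ker Γ), inferInstance⟩

theorem coe_lift (Q : ProbabilityMeasure (Prob Γ)) :
    (lift Q : Measure (ProbPt Γ)) = (Q : Measure (Prob Γ)).compProd (ker Γ) := rfl

theorem lintegral_lift (Q : ProbabilityMeasure (Prob Γ)) {f : ProbPt Γ → ℝ≥0∞}
    (hf : Measurable f) : ∫⁻ p, f p ∂(lift Q : Measure (ProbPt Γ)) =
      ∫⁻ μ, ∫⁻ x, f (μ, x) ∂(μ : Measure Γ) ∂(Q : Measure (Prob Γ)) :=
  Measure.lintegral_compProd hf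

theorem fst_lift (Q : ProbabilityMeasure (Prob Γ)) :
    (lift Q : Measure (ProbPt Γ)).map Prod.fst = (Q : Measure (Prob Γ)) :=
  Measure.fst_compProd _ _

theorem lift_injective : Function.Injective (lift (Γ := Γ)) := by
  intro Q R h
  refine Subtype.ext ?_
  change (Q : Measure (Prob Γ)) = R
  rw [← fst_lift Q, ← fst_lift R, h]

/-- The Markov transition `Q ↦ ∫∑_a μ([a]) δ_{μ_a} dQ(μ)`. -/
def step (hσ : MapsTo shift Γ Γ) (Q : ProbabilityMeasure (Prob Γ)) :
    ProbabilityMeasure (Prob Γ) :=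
  (lift Q).map (f := fun p => (cpMap hσ p).1) (measurable_cpMap hσ).fst.aemeasurable

theorem coe_step (hσ : MapsTo shift Γ Γ) (Q : ProbabilityMeasure (Prob Γ)) :
    (step hσ Q : Measure (Prob Γ)) =
      (lift Q : Measure (ProbPt Γ)).map fun p => (cpMap hσ p).1 := rfl

theorem lintegral_eq_tsum_pref (ν : Measure Γ) (n : ℕ) (f : Γ → ℝ≥0∞) :
    ∫⁻ x, f x ∂ν = ∑' w : Word κ, ∫⁻ x in {x : Γ | pref x.1 n = w}, f x ∂ν := by
  let _ : MeasurableSpace (Word κ) := ⊤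
  have hm : Measurable fun x : Γ => pref x.1 n := measurable_comp_pref id n
  rw [← lintegral_iUnion (s := fun w => {x : Γ | pref x.1 n = w})
    (fun w => hm (measurableSet_singleton w)) fun u v huv =>
      disjoint_left.2 fun x hx hx' => huv (hx.symm.trans hx'),
    show (⋃ w, {x : Γ | pref x.1 n = w}) = univ by ext x; simp, setLIntegral_univ]

theorem setOf_pref_eq (w : Word κ) (n : ℕ) :
    {x : Γ | pref x.1 n = w} = cylIn Γ w ∧ w.length = n ∨ {x : Γ | pref x.1 n = w} = ∅ := by
  by_cases h : w.length = n
  · left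
    subst h
    exact ⟨rfl, rfl⟩
  · right
    ext x
    simp only [mem_ofPred_eq, mem_empty_iff_false, iff_false]
    rintro rfl
    exact h (length_pref _ _)

/-- The definition of μ_w with its denominator cleared; in this form it also holds for null
cylinders, whatever the default value is. -/
theorem setLIntegral_cylIn (hσ : MapsTo shift Γ Γ) (μ : Prob Γ) (w : Word κ) {f : Γ → ℝ≥0∞}
    (hf : Measurable f) : ∫⁻ x in cylIn Γ w, f ((shiftIn hσ)^[w.length] x) ∂(μ : Measure Γ) =
      (μ : Measure Γ) (cylIn Γ w) * ∫⁻ y, f y ∂(condWord hσ μ w : Measure Γ) := by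
  by_cases h : (μ : Measure Γ) (cylIn Γ w) = 0
  · rw [h, zero_mul, Measure.restrict_eq_zero.2 h, lintegral_zero_measure]
  · rw [condWord, dif_neg h]
    change _ = _ * ∫⁻ y, f y ∂(Measure.map (shiftIn hσ)^[w.length]
      (ProbabilityTheory.cond (μ : Measure Γ) (cylIn Γ w)))
    rw [lintegral_map hf ((continuous_shiftIn hσ).iterate w.length).measurable,
      ProbabilityTheory.cond, lintegral_smul_measure, smul_eq_mul, ← mul_assoc,
      ENNReal.mul_inv_cancel h (measure_ne_top _ _), one_mul]

/-- Conditional distribution of `M^n` given the first `n` letters. -/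
theorem lintegral_condWord_shiftIn (hσ : MapsTo shift Γ Γ) (μ : Prob Γ) (n : ℕ)
    {F : ProbPt Γ → ℝ≥0∞} (hF : Measurable F) :
    ∫⁻ x, F (condWord hσ μ (pref x.1 n), (shiftIn hσ)^[n] x) ∂(μ : Measure Γ) =
      ∫⁻ x, ∫⁻ y, F (condWord hσ μ (pref x.1 n), y)
        ∂(condWord hσ μ (pref x.1 n) : Measure Γ) ∂(μ : Measure Γ) := by
  rw [lintegral_eq_tsum_pref _ n, lintegral_eq_tsum_pref (μ : Measure Γ) n]
  congr 1
  ext w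
  rcases setOf_pref_eq (Γ := Γ) w n with ⟨h, rfl⟩ | h
  · rw [h]
    have e : ∀ x ∈ cylIn Γ w, pref x.1 w.length = w := fun x hx => hx
    have e1 : ∫⁻ x in cylIn Γ w, F (condWord hσ μ (pref x.1 w.length), (shiftIn hσ)^[w.length] x)
        ∂(μ : Measure Γ) = ∫⁻ x in cylIn Γ w, F (condWord hσ μ w, (shiftIn hσ)^[w.length] x)
        ∂(μ : Measure Γ) :=
      setLIntegral_congr_fun (measurableSet_cylIn Γ w) fun x hx => by simp only [e x hx]
    have e2 : ∫⁻ x in cylIn Γ w, ∫⁻ y, F (condWord hσ μ (pref x.1 w.length), y)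
        ∂(condWord hσ μ (pref x.1 w.length) : Measure Γ) ∂(μ : Measure Γ) =
        ∫⁻ x in cylIn Γ w, ∫⁻ y, F (condWord hσ μ w, y) ∂(condWord hσ μ w : Measure Γ)
        ∂(μ : Measure Γ) :=
      setLIntegral_congr_fun (measurableSet_cylIn Γ w) fun x hx => by simp only [e x hx]
    rw [e1, e2, setLIntegral_const, mul_comm]
    exact setLIntegral_cylIn hσ μ w (hF.comp measurable_prodMk_left)
  · rw [h]
    simp

/-- Given the first letter of x, the point σ(x) has law μ_{x|_1}. So M carries adapted distributions
to adapted ones, and M-invariance of a lift is stationarity of its first marginal. -/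
theorem lift_step (hσ : MapsTo shift Γ Γ) (Q : ProbabilityMeasure (Prob Γ)) :
    (lift (step hσ Q) : Measure (ProbPt Γ)) = (lift Q : Measure (ProbPt Γ)).map (cpMap hσ) := by
  refine Measure.ext_of_lintegral _ fun F hF => ?_
  have hG : Measurable fun μ : Prob Γ => ∫⁻ x, F (μ, x) ∂(μ : Measure Γ) :=
    Measurable.lintegral_kernel_prod_right' (κ := ker Γ) hF
  rw [lintegral_lift _ hF, coe_step, lintegral_map hG (measurable_cpMap hσ).fst,
    lintegral_map hF (measurable_cpMap hσ),
    lintegral_lift (f := fun p => F (cpMap hσ p)) _ (hF.comp (measurable_cpMap hσ)),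
    lintegral_lift (f := fun p => ∫⁻ x, F ((cpMap hσ p).1, x) ∂((cpMap hσ p).1 : Measure Γ)) _
      (hG.comp (measurable_cpMap hσ).fst)]
  refine lintegral_congr fun μ => ?_
  exact (lintegral_condWord_shiftIn hσ μ 1 hF).symm

theorem measurePreserving_lift (hσ : MapsTo shift Γ Γ) {Q : ProbabilityMeasure (Prob Γ)}
    (hQ : step hσ Q = Q) :
    MeasurePreserving (cpMap hσ) (lift Q : Measure (ProbPt Γ)) (lift Q : Measure (ProbPt Γ)) :=
  ⟨measurable_cpMap hσ, by rw [← lift_step, hQ]⟩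

theorem step_eq_of_map_eq (hσ : MapsTo shift Γ Γ) {Q : ProbabilityMeasure (Prob Γ)}
    (hQ : (lift Q : Measure (ProbPt Γ)).map (cpMap hσ) = lift Q) : step hσ Q = Q :=
  lift_injective (Subtype.ext ((lift_step hσ Q).trans hQ))

end CPMap

/-! ### The Feller property and the entropy functional -/

section Feller

variable {κ : ℕ} {Γ : Set (Shift κ)}

theorem continuous_real_cylIn (w : Word κ) :
    Continuous fun μ : Prob Γ => (μ : Measure Γ).real (cylIn Γ w) := by
  have : Continuous fun μ : Prob Γ => μ (cylIn Γ w) := continuous_iff_continuousAt.2 fun μ =>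
    ProbabilityMeasure.tendsto_measure_of_isClopen_of_tendsto tendsto_id
      ((isClopen_cyl w).preimage continuous_subtype_val)
  exact NNReal.continuous_coe.comp this

/-- A continuous injection of the compact space P(Γ): its weak topology is that of convergence of
all cylinder masses. -/
theorem isEmbedding_real_cylIn [CompactSpace Γ] :
    IsEmbedding fun (μ : Prob Γ) (w : Word κ) => (μ : Measure Γ).real (cylIn Γ w) := by
  refine (Continuous.isClosedEmbedding (continuous_pi continuous_real_cylIn) ?_).isEmbedding
  intro μ ν h
  refine prob_ext fun w => ?_
  have : (μ : Measure Γ).real (cylIn Γ w) = (ν : Measure Γ).real (cylIn Γ w) := congrFun h w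
  rwa [measureReal_def, measureReal_def, ENNReal.toReal_eq_toReal_iff' (measure_ne_top _ _)
    (measure_ne_top _ _)] at this

theorem tendsto_prob_iff [CompactSpace Γ] {ι : Type*} {l : Filter ι} {f : ι → Prob Γ}
    {μ : Prob Γ} : Tendsto f l (𝓝 μ) ↔ ∀ w, Tendsto
      (fun i => (f i : Measure Γ).real (cylIn Γ w)) l (𝓝 ((μ : Measure Γ).real (cylIn Γ w))) := by
  rw [isEmbedding_real_cylIn.tendsto_nhds_iff, tendsto_pi_nhds]
  rfl

instance [CompactSpace Γ] : TopologicalSpace.MetrizableSpace (Prob Γ) :=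
  isEmbedding_real_cylIn.metrizableSpace

instance [CompactSpace Γ] : BorelSpace (Prob Γ) :=
  borelSpace_prob (isCompact_iff_compactSpace.2 inferInstance)

theorem continuousAt_condWord [CompactSpace Γ] (hσ : MapsTo shift Γ Γ) {μ : Prob Γ} {w : Word κ}
    (h : (μ : Measure Γ) (cylIn Γ w) ≠ 0) : ContinuousAt (fun ν => condWord hσ ν w) μ := by
  have hreal : (μ : Measure Γ).real (cylIn Γ w) ≠ 0 :=
    (ENNReal.toReal_pos h (measure_ne_top _ _)).ne'
  have hev := (continuous_real_cylIn (Γ := Γ) w).continuousAt.eventually_ne hreal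
  refine tendsto_prob_iff.2 fun v => ?_
  have key : ∀ ν : Prob Γ, (ν : Measure Γ).real (cylIn Γ w) ≠ 0 →
      (condWord hσ ν w : Measure Γ).real (cylIn Γ v) =
        (ν : Measure Γ).real (cylIn Γ (w ++ v)) / (ν : Measure Γ).real (cylIn Γ w) := by
    intro ν hν
    rw [measureReal_def, condWord_cyl hσ ν w v (fun h0 => hν (by simp [measureReal_def, h0])),
      ENNReal.toReal_div]
    rfl
  rw [key μ hreal]
  refine Tendsto.congr' (hev.mono fun ν hν => (key ν hν).symm) ?_
  exact (continuous_real_cylIn _).continuousAt.div (continuous_real_cylIn _).continuousAt hreal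

theorem cylIn_singleton (a : Fin κ) : cylIn Γ [a] = {x : Γ | x.1 0 = a} := by
  ext x
  change pref x.1 1 = [a] ↔ _
  simp [pref_one]

theorem measurable_letter : Measurable fun x : Γ => x.1 0 :=
  (measurable_pi_apply 0).comp measurable_subtype_coe

theorem integral_letter (μ : Prob Γ) (f : Fin κ → ℝ) :
    ∫ x, f (x.1 0) ∂(μ : Measure Γ) = ∑ a, (μ : Measure Γ).real (cylIn Γ [a]) * f a := by
  have := Measure.isProbabilityMeasure_map (μ := (μ : Measure Γ))
    (measurable_letter (Γ := Γ)).aemeasurable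
  rw [← integral_map measurable_letter.aemeasurable (f := f)
    (Measurable.of_discrete).aestronglyMeasurable,
    integral_fintype .of_finite]
  refine Finset.sum_congr rfl fun a _ => ?_
  rw [map_measureReal_apply measurable_letter (measurableSet_singleton a), cylIn_singleton,
    smul_eq_mul]
  rfl

theorem integrable_letter (μ : Prob Γ) (f : Fin κ → ℝ) :
    Integrable (fun x : Γ => f (x.1 0)) (μ : Measure Γ) := by
  have := Measure.isProbabilityMeasure_map (μ := (μ : Measure Γ))
    (measurable_letter (Γ := Γ)).aemeasurable
  exact (Integrable.of_finite (μ := (μ : Measure Γ).map fun x : Γ => x.1 0) (f := f)).comp_measurable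
    measurable_letter

theorem integral_step (hσ : MapsTo shift Γ Γ) [CompactSpace Γ]
    (Q : ProbabilityMeasure (Prob Γ)) (G : C(Prob Γ, ℝ)) :
    ∫ μ, G μ ∂(step hσ Q : Measure (Prob Γ)) =
      ∫ μ, ∑ a, (μ : Measure Γ).real (cylIn Γ [a]) * G (condWord hσ μ [a])
        ∂(Q : Measure (Prob Γ)) := by
  have hm := G.continuous.measurable
  have hb : Integrable (fun p => G (cpMap hσ p).1) (lift Q : Measure (ProbPt Γ)) := by
    refine Integrable.of_bound (hm.comp (measurable_cpMap hσ).fst).aestronglyMeasurable ‖G‖ ?_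
    exact Eventually.of_forall fun p => G.norm_coe_le_norm _
  rw [coe_step, integral_map (measurable_cpMap hσ).fst.aemeasurable hm.aestronglyMeasurable,
    coe_lift, Measure.integral_compProd hb]
  refine integral_congr_ae (Eventually.of_forall fun μ => ?_)
  simp only [ker_apply]
  rw [← integral_letter μ fun a => G (condWord hσ μ [a])]
  simp [cpMap, pref_one]

/-- Where μ([a]) > 0, μ_a depends continuously on μ. Where μ([a]) = 0 it may jump, but its weight
tends to 0 and G is bounded. -/
theorem continuous_transition [CompactSpace Γ] (hσ : MapsTo shift Γ Γ) (G : C(Prob Γ, ℝ)) :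
    Continuous fun μ : Prob Γ =>
      ∑ a, (μ : Measure Γ).real (cylIn Γ [a]) * G (condWord hσ μ [a]) := by
  refine continuous_finsetSum _ fun a _ => continuous_iff_continuousAt.2 fun μ => ?_
  by_cases h : (μ : Measure Γ) (cylIn Γ [a]) = 0
  · have h0 : (μ : Measure Γ).real (cylIn Γ [a]) = 0 := by simp [measureReal_def, h]
    have hlim : Tendsto (fun ν : Prob Γ => (ν : Measure Γ).real (cylIn Γ [a])) (𝓝 μ) (𝓝 0) :=
      h0 ▸ (continuous_real_cylIn [a]).continuousAt
    rw [ContinuousAt, h0, zero_mul]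
    refine hlim.zero_mul_isBoundedUnder_le (isBoundedUnder_of ⟨‖G‖, fun ν => ?_⟩)
    exact G.norm_coe_le_norm _
  · exact (continuous_real_cylIn [a]).continuousAt.mul
      (G.continuous.continuousAt.comp (continuousAt_condWord hσ h))

theorem continuous_step [CompactSpace Γ] (hσ : MapsTo shift Γ Γ) : Continuous (step hσ) := by
  rw [ProbabilityMeasure.continuous_iff_forall_continuousMap_continuous_integral]
  intro G
  simp_rw [integral_step]
  exact ProbabilityMeasure.continuous_integral_continuousMap
    (⟨_, continuous_transition hσ G⟩ : C(Prob Γ, ℝ))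

theorem isAdaptedTo_lift [CompactSpace Γ] (Q : ProbabilityMeasure (Prob Γ)) :
    IsAdaptedTo (lift Q) Q := by
  intro f
  have hb : Integrable f (lift Q : Measure (ProbPt Γ)) := by
    refine Integrable.of_bound f.continuous.measurable.aestronglyMeasurable ‖f‖ ?_
    exact Eventually.of_forall fun p => f.norm_coe_le_norm _
  rw [coe_lift] at hb ⊢
  rw [Measure.integral_compProd hb]
  rfl

theorem isCP_lift [CompactSpace Γ] (hσ : MapsTo shift Γ Γ) {Q : ProbabilityMeasure (Prob Γ)}
    (hQ : step hσ Q = Q) : IsCP hσ (lift Q) :=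
  ⟨measurePreserving_lift hσ hQ, Q, isAdaptedTo_lift Q⟩

/-- The entropy of `μ` with respect to the partition into cylinders of length one. -/
def entropyOne (Γ : Set (Shift κ)) : C(Prob Γ, ℝ) where
  toFun μ := ∑ a, Real.negMulLog ((μ : Measure Γ).real (cylIn Γ [a]))
  continuous_toFun := continuous_finsetSum _ fun a _ =>
    Real.continuous_negMulLog.comp (continuous_real_cylIn [a])

theorem measurable_info : Measurable (info (Γ := Γ)) := by
  classical
  unfold info
  refine Measurable.ite measurableSet_omega ?_ measurable_const
  refine (measurable_uncurry_pref
    (f := fun (μ : Prob Γ) w => -Real.log ((μ : Measure Γ).real (cylIn Γ w))) (fun w => ?_) 1)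
  exact (Real.measurable_log.comp ((Measure.measurable_coe (measurableSet_cylIn Γ w)).comp
    measurable_subtype_coe).ennreal_toReal).neg

theorem info_nonneg (p : ProbPt Γ) : 0 ≤ info p := by
  unfold info
  split_ifs
  · rw [neg_nonneg]
    exact Real.log_nonpos measureReal_nonneg measureReal_le_one
  · exact le_rfl

theorem info_ae_eq (μ : Prob Γ) : (fun x : Γ => info (μ, x)) =ᵐ[(μ : Measure Γ)]
    fun x => -Real.log ((μ : Measure Γ).real (cylIn Γ [x.1 0])) := by
  filter_upwards [ae_mem_omega μ] with x hx
  rw [info, if_pos hx, pref_one]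

theorem integral_info_eq (μ : Prob Γ) :
    ∫ x, info (μ, x) ∂(μ : Measure Γ) = entropyOne Γ μ := by
  rw [integral_congr_ae (info_ae_eq μ),
    integral_letter μ fun a => -Real.log ((μ : Measure Γ).real (cylIn Γ [a]))]
  refine Finset.sum_congr rfl fun a _ => ?_
  rw [Real.negMulLog]
  ring

/-- `info` may be unbounded, but it is nonnegative and its fibre integrals are values of the bounded
function `entropyOne`. -/
theorem integrable_info [CompactSpace Γ] (Q : ProbabilityMeasure (Prob Γ)) :
    Integrable info (lift Q : Measure (ProbPt Γ)) := by
  rw [coe_lift, Measure.integrable_compProd_iff measurable_info.aestronglyMeasurable]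
  constructor
  · refine Eventually.of_forall fun μ => ?_
    rw [ker_apply]
    exact (integrable_letter μ fun a => -Real.log ((μ : Measure Γ).real (cylIn Γ [a]))).congr (info_ae_eq μ).symm
  · refine Integrable.of_bound (C := ‖entropyOne Γ‖) ?_ ?_
    · exact (measurable_info.norm.stronglyMeasurable.integral_kernel_prod_right'
        (κ := ker Γ)).aestronglyMeasurable
    · refine Eventually.of_forall fun μ => ?_
      have : ∫ x, ‖info (μ, x)‖ ∂(ker Γ μ) = entropyOne Γ μ := by
        rw [← integral_info_eq, ker_apply]
        exact integral_congr_ae (Eventually.of_forall fun x => Real.norm_of_nonneg (info_nonneg _))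
      rw [this]
      exact (entropyOne Γ).norm_coe_le_norm μ

theorem integral_info_lift [CompactSpace Γ] (Q : ProbabilityMeasure (Prob Γ)) :
    ∫ p, info p ∂(lift Q : Measure (ProbPt Γ)) =
      ∫ μ, entropyOne Γ μ ∂(Q : Measure (Prob Γ)) := by
  rw [coe_lift, Measure.integral_compProd (by rw [← coe_lift]; exact integrable_info Q)]
  exact integral_congr_ae (Eventually.of_forall integral_info_eq)

end Feller

/-! ### Measures on microsets, and a stationary distribution of entropy L -/

section MicroMeasures

variable {κ : ℕ} {Γ A : Set (Shift κ)}

/-- The measures whose support is, at every resolution, covered by a miniset of `A`. -/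
def microProb (Γ A : Set (Shift κ)) : Set (Prob Γ) :=
  {μ | ∀ n, ∃ w : Word κ, ∀ v : Word κ, v.length = n → (μ : Measure Γ) (cylIn Γ v) ≠ 0 →
    (beta w A ∩ cyl v).Nonempty}

/-- For fixed n the word w matters only through the n-prefixes of β_w(A). This leaves finitely many
cases, each requiring certain cylinder masses to vanish. -/
theorem isClosed_microProb : IsClosed (microProb Γ A) := by
  have e : microProb Γ A = ⋂ n : ℕ, ⋃ S ∈ range fun w : Word κ => prefixes (beta w A) n,
      ⋂ v ∈ {v : Word κ | v.length = n ∧ v ∉ S},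
        {μ : Prob Γ | (μ : Measure Γ).real (cylIn Γ v) = 0} := by
    ext μ
    simp only [microProb, mem_ofPred_eq, mem_iInter, mem_iUnion, mem_range, exists_prop,
      exists_exists_eq_and, mem_prefixes_iff]
    refine forall_congr' fun n => exists_congr fun w => forall_congr' fun v => ?_
    rw [measureReal_eq_zero_iff]
    tauto
  rw [e]
  refine isClosed_iInter fun n => Finite.isClosed_biUnion ?_ fun S _ =>
    isClosed_biInter fun v _ => isClosed_eq (continuous_real_cylIn v) continuous_const
  refine (List.finite_length_eq (Fin κ) n).finite_subsets.subset ?_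
  rintro _ ⟨w, rfl⟩ v hv
  exact (mem_prefixes_iff.1 hv).1

/-- A Hausdorff limit of minisets covering μ at finer and finer resolutions meets every cylinder
around a support point, and it is closed. -/
theorem exists_isMicroset_of_mem_microProb (hΓ : IsCompact Γ) (hσ : MapsTo shift Γ Γ)
    (hAΓ : A ⊆ Γ) (hA : IsCompact A) {μ : Prob Γ} (hμ : μ ∈ microProb Γ A) :
    ∃ A', IsMicroset Γ A A' ∧ spt μ ⊆ A' := by
  choose w hw using hμ
  obtain ⟨C, hC, φ, hφ, hlim⟩ := exists_tendsto_hausdorff fun n => isCompact_beta hA (w n)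
  refine ⟨C, ⟨hC, fun x hx => ?_, fun n => beta (w (φ n)) A, fun n => ⟨_, rfl⟩, hlim⟩, ?_⟩
  · refine mem_of_forall_nonempty_inter_cyl hΓ.isClosed fun n => ?_
    obtain ⟨k, hk⟩ := (eventually_prefixes_eq hlim n).exists
    have h1 : pref x n ∈ prefixes (beta (w (φ k)) A) n := hk ▸ ⟨x, hx, rfl⟩
    exact (mem_prefixes_iff.1 h1).2.mono (inter_subset_inter_left _ (beta_subset hσ hAΓ _))
  · rintro _ ⟨x, hx, rfl⟩
    have hx' := mem_omega_iff.1 (show (μ, x) ∈ omega Γ from ⟨x, hx, rfl⟩)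
    refine mem_of_forall_nonempty_inter_cyl hC.isClosed fun n => ?_
    obtain ⟨k, hk, hkn⟩ := ((eventually_prefixes_eq hlim n).and
      (hφ.tendsto_atTop.eventually_ge_atTop n)).exists
    have h1 := hw (φ k) (pref x.1 (φ k)) (length_pref _ _) (hx' _)
    have h2 : pref x.1 n ∈ prefixes (beta (w (φ k)) A) n := mem_prefixes_iff.2
      ⟨length_pref _ _, h1.mono (inter_subset_inter_right _ (cyl_pref_anti x.1 hkn))⟩
    exact (mem_prefixes_iff.1 (hk ▸ h2)).2

/-- If β_w(A) covers μ at resolution |u| + n, then β_{wu}(A) covers μ_u at resolution n. -/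
theorem condWord_mem_microProb (hσ : MapsTo shift Γ Γ) {μ : Prob Γ} (hμ : μ ∈ microProb Γ A)
    {u : Word κ} (hu : (μ : Measure Γ) (cylIn Γ u) ≠ 0) : condWord hσ μ u ∈ microProb Γ A := by
  intro n
  obtain ⟨w, hw⟩ := hμ (u.length + n)
  refine ⟨w ++ u, fun v hv h => ?_⟩
  rw [condWord_cyl hσ μ u v hu] at h
  have := hw (u ++ v) (by simp [hv]) (ENNReal.div_ne_zero.1 h).1
  rw [nonempty_beta_inter_cyl] at this ⊢
  rwa [List.append_assoc]

theorem ae_mem_microProb_step [CompactSpace Γ] (hσ : MapsTo shift Γ Γ)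
    {Q : ProbabilityMeasure (Prob Γ)} (hQ : ∀ᵐ μ ∂(Q : Measure (Prob Γ)), μ ∈ microProb Γ A) :
    ∀ᵐ μ ∂(step hσ Q : Measure (Prob Γ)), μ ∈ microProb Γ A := by
  have hK : MeasurableSet (microProb Γ A) := isClosed_microProb.measurableSet
  rw [coe_step, ae_map_iff (p := fun μ => μ ∈ microProb Γ A)
    (measurable_cpMap hσ).fst.aemeasurable hK, coe_lift]
  refine Measure.ae_compProd_of_ae_ae ((measurable_cpMap hσ).fst hK) ?_
  filter_upwards [hQ] with μ hμ
  rw [ker_apply]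
  filter_upwards [ae_mem_omega μ] with x hx
  exact condWord_mem_microProb hσ hμ (mem_omega_iff.1 hx 1)

/-- By the portmanteau theorem the mass of a closed set is upper semicontinuous, so mass 1 persists
in limits. -/
theorem isClosed_setOf_ae_mem {X : Type*} [TopologicalSpace X] [MeasurableSpace X]
    [OpensMeasurableSpace X] [HasOuterApproxClosed X] {K : Set X} (hK : IsClosed K) :
    IsClosed {Q : ProbabilityMeasure X | ∀ᵐ x ∂(Q : Measure X), x ∈ K} := by
  have h1 : ∀ Q : ProbabilityMeasure X, (∀ᵐ x ∂(Q : Measure X), x ∈ K) ↔ (Q : Measure X) K = 1 :=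
    fun Q => by rw [← prob_compl_eq_zero_iff hK.measurableSet]; rfl
  refine isClosed_of_closure_subset fun Q hQ => ?_
  rw [mem_closure_iff_nhdsWithin_neBot] at hQ
  have hlim : Tendsto (fun R : ProbabilityMeasure X => R)
      (𝓝[{Q : ProbabilityMeasure X | ∀ᵐ x ∂(Q : Measure X), x ∈ K}] Q) (𝓝 Q) :=
    tendsto_id.mono_left nhdsWithin_le_nhds
  have h2 := ProbabilityMeasure.limsup_measure_closed_le_of_tendsto hlim hK
  refine (h1 Q).2 (le_antisymm prob_le_one (le_trans ?_ h2))
  have hev : ∀ᶠ R : ProbabilityMeasure X in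
      𝓝[{Q : ProbabilityMeasure X | ∀ᵐ x ∂(Q : Measure X), x ∈ K}] Q, (R : Measure X) K = 1 :=
    eventually_mem_nhdsWithin.mono fun R hR => (h1 R).1 hR
  rw [limsup_congr hev, limsup_const]

/-- A measure that is equidistributed on the `n`-cylinders of a largest miniset. -/
theorem exists_equidistributed (hσ : MapsTo shift Γ Γ) (hAΓ : A ⊆ Γ) (hA : IsCompact A)
    (hne : A.Nonempty) (n : ℕ) : ∃ μ ∈ microProb Γ A, ∀ᵐ x ∂(μ : Measure Γ),
      (μ : Measure Γ).real (cylIn Γ (pref x.1 n)) = (maxCount Γ A n : ℝ)⁻¹ := by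
  classical
  obtain ⟨w, hw⟩ := exists_ncard_prefixes_beta_eq hσ hAΓ hA n
  have hN1 := one_le_maxCount hσ hAΓ hA hne n
  generalize maxCount Γ A n = N at hw hN1 ⊢
  have hN0 : (N : ℝ≥0∞) ≠ 0 := by exact_mod_cast (by omega : N ≠ 0)
  set S := (finite_prefixes (beta w A) n).toFinset
  have hcard : S.card = N := by rw [← hw, ncard_eq_toFinset_card _ (finite_prefixes _ _)]
  have hmem : ∀ v : S, v.1.length = n ∧ (beta w A ∩ cyl v.1).Nonempty := fun v =>
    mem_prefixes_iff.1 ((finite_prefixes (beta w A) n).mem_toFinset.1 v.2)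
  choose hlen c hcA hcv using hmem
  let pt : S → Γ := fun v => ⟨c v, beta_subset hσ hAΓ w (hcA v)⟩
  -- The atoms lie in β_w(A) itself, so the same w witnesses membership in `microProb` at every
  -- resolution.
  let m : Measure Γ := (N : ℝ≥0∞)⁻¹ • ∑ v, Measure.dirac (pt v)
  have hm : IsProbabilityMeasure m := ⟨by
    simp only [m, Measure.smul_apply, Measure.finsetSum_apply, measure_univ, Finset.sum_const,
      Finset.card_univ, Fintype.card_coe, hcard, smul_eq_mul, nsmul_eq_mul, mul_one]
    exact ENNReal.inv_mul_cancel hN0 (ENNReal.natCast_ne_top N)⟩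
  have hae : ∀ᵐ x ∂m, ∃ v, x = pt v := by
    refine Measure.ae_smul_measure ?_ _
    rw [ae_finsetSum_measure_iff]
    intro v _
    rw [ae_dirac_eq]
    exact ⟨v, rfl⟩
  suffices h : ∀ᵐ x ∂m, m.real (cylIn Γ (pref x.1 n)) = (N : ℝ)⁻¹ by
    refine ⟨⟨m, hm⟩, fun k => ⟨w, fun v _ hv => ?_⟩, h⟩
    by_contra hcon
    refine hv ?_
    change m (cylIn Γ v) = 0
    have h0 : m {x | ¬ ∃ v, x = pt v} = 0 := hae
    refine measure_mono_null ?_ h0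
    rintro x hx ⟨u, rfl⟩
    exact hcon ⟨c u, hcA u, hx⟩
  · filter_upwards [hae] with x hx
    obtain ⟨u, rfl⟩ := hx
    have e1 : pref (pt u).1 n = u.1 := by
      have h1 := hcv u
      change pref (c u) u.1.length = u.1 at h1
      rwa [hlen u] at h1
    have e2 : ∀ v : S, pt v ∈ cylIn Γ u.1 ↔ v = u := by
      intro v
      constructor
      · intro h
        have h1 : pref (c v) u.1.length = u.1 := h
        have h2 : pref (c v) v.1.length = v.1 := hcv v
        rw [hlen] at h1 h2
        exact Subtype.ext (h2.symm.trans h1)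
      · rintro rfl
        exact hcv v
    have e3 : m (cylIn Γ u.1) = (N : ℝ≥0∞)⁻¹ := by
      simp only [m, Measure.smul_apply, Measure.finsetSum_apply,
        Measure.dirac_apply' _ (measurableSet_cylIn Γ u.1), indicator_apply, e2]
      simp
    rw [e1, measureReal_def, e3]
    simp

theorem lift_step_iterate (hσ : MapsTo shift Γ Γ) (Q : ProbabilityMeasure (Prob Γ)) (k : ℕ) :
    (lift ((step hσ)^[k] Q) : Measure (ProbPt Γ)) =
      (lift Q : Measure (ProbPt Γ)).map (cpMap hσ)^[k] := by
  induction k with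
  | zero => simp
  | succ k ih =>
    rw [Function.iterate_succ_apply', lift_step, ih, Function.iterate_succ',
      Measure.map_map (measurable_cpMap hσ) ((measurable_cpMap hσ).iterate k)]

theorem integrable_info_iterate [CompactSpace Γ] (hσ : MapsTo shift Γ Γ)
    (Q : ProbabilityMeasure (Prob Γ)) (k : ℕ) :
    Integrable (fun p => info ((cpMap hσ)^[k] p)) (lift Q : Measure (ProbPt Γ)) := by
  have := integrable_info ((step hσ)^[k] Q)
  rw [lift_step_iterate] at this
  exact this.comp_measurable ((measurable_cpMap hσ).iterate k)

theorem sum_integral_entropyOne_step [CompactSpace Γ] (hσ : MapsTo shift Γ Γ)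
    (Q : ProbabilityMeasure (Prob Γ)) (n : ℕ) :
    ∑ k ∈ Finset.range n, ∫ μ, entropyOne Γ μ ∂((step hσ)^[k] Q : Measure (Prob Γ)) =
      ∫ μ, ∫ x, -Real.log ((μ : Measure Γ).real (cylIn Γ (pref x.1 n))) ∂(μ : Measure Γ)
        ∂(Q : Measure (Prob Γ)) := by
  have hi := integrable_info_iterate hσ Q
  have e : ∀ k, ∫ μ, entropyOne Γ μ ∂((step hσ)^[k] Q : Measure (Prob Γ)) =
      ∫ p, info ((cpMap hσ)^[k] p) ∂(lift Q : Measure (ProbPt Γ)) := fun k => by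
    rw [← integral_info_lift, lift_step_iterate,
      integral_map ((measurable_cpMap hσ).iterate k).aemeasurable
        measurable_info.aestronglyMeasurable]
  simp_rw [e]
  rw [← integral_finsetSum _ fun k _ => hi k, coe_lift, Measure.integral_compProd
    (by rw [← coe_lift]; exact integrable_finsetSum _ fun k _ => hi k)]
  refine integral_congr_ae (Eventually.of_forall fun μ => ?_)
  simp only [ker_apply]
  refine integral_congr_ae ?_
  filter_upwards [ae_mem_omega μ] with x hx
  exact birkhoffSum_info hσ hx n

/-- The average of the first `n + 1` terms of a sequence of probability measures. -/
def average {X : Type*} [MeasurableSpace X] (f : ℕ → ProbabilityMeasure X) (n : ℕ) :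
    ProbabilityMeasure X :=
  ⟨((n + 1 : ℕ) : ℝ≥0∞)⁻¹ • ∑ k ∈ Finset.range (n + 1), (f k : Measure X), ⟨by
    simp only [Measure.smul_apply, Measure.finsetSum_apply, measure_univ, Finset.sum_const,
      Finset.card_range, smul_eq_mul, nsmul_eq_mul, mul_one]
    exact ENNReal.inv_mul_cancel (by exact_mod_cast n.succ_ne_zero) (ENNReal.natCast_ne_top _)⟩⟩

theorem coe_average {X : Type*} [MeasurableSpace X] (f : ℕ → ProbabilityMeasure X) (n : ℕ) :
    (average f n : Measure X) =
      ((n + 1 : ℕ) : ℝ≥0∞)⁻¹ • ∑ k ∈ Finset.range (n + 1), (f k : Measure X) := rfl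

theorem integral_average {X : Type*} [TopologicalSpace X] [CompactSpace X] [MeasurableSpace X]
    [OpensMeasurableSpace X] (f : ℕ → ProbabilityMeasure X) (n : ℕ) (g : C(X, ℝ)) :
    ∫ x, g x ∂(average f n : Measure X) =
      ((n + 1 : ℕ) : ℝ)⁻¹ * ∑ k ∈ Finset.range (n + 1), ∫ x, g x ∂(f k : Measure X) := by
  rw [coe_average, integral_smul_measure, integral_finsetSum_measure]
  · rw [ENNReal.toReal_inv, ENNReal.toReal_natCast, smul_eq_mul]
  · intro k _
    exact Integrable.of_bound g.continuous.measurable.aestronglyMeasurable ‖g‖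
      (Eventually.of_forall fun p => g.norm_coe_le_norm _)

theorem abs_integral_le_norm {X : Type*} [TopologicalSpace X] [CompactSpace X]
    [MeasurableSpace X] (Q : ProbabilityMeasure X) (g : C(X, ℝ)) :
    |∫ x, g x ∂(Q : Measure X)| ≤ ‖g‖ := by
  have := norm_integral_le_of_norm_le_const (μ := (Q : Measure X))
    (Eventually.of_forall fun p => g.norm_coe_le_norm p)
  simpa using this

theorem exists_stationary (hΓ : IsCompact Γ) (hσ : MapsTo shift Γ Γ) (hAΓ : A ⊆ Γ)
    (hA : IsCompact A) (hne : A.Nonempty) {L : ℝ}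
    (hL : Tendsto (fun n : ℕ => 1 / (n : ℝ) * Real.log (maxCount Γ A n)) atTop (𝓝 L)) :
    ∃ Q : ProbabilityMeasure (Prob Γ), step hσ Q = Q ∧
      (∀ᵐ μ ∂(Q : Measure (Prob Γ)), μ ∈ microProb Γ A) ∧
      ∫ μ, entropyOne Γ μ ∂(Q : Measure (Prob Γ)) = L := by
  have : CompactSpace Γ := isCompact_iff_compactSpace.1 hΓ
  choose μ hμK hμ using exists_equidistributed hσ hAΓ hA hne
  -- `average` at n has n + 1 terms, hence the starting measure is the one that is equidistributed
  -- at level n + 1.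
  let δ : ℕ → ProbabilityMeasure (Prob Γ) := fun n => ⟨Measure.dirac (μ (n + 1)), inferInstance⟩
  let R : ℕ → ProbabilityMeasure (Prob Γ) := fun n => average (fun k => (step hσ)^[k] (δ n)) n
  let U : Ultrafilter ℕ := hyperfilter ℕ
  have hU : (U : Filter ℕ) ≤ atTop := Nat.hyperfilter_le_atTop
  obtain ⟨Q, -, hQ⟩ := isCompact_univ.ultrafilter_le_nhds (U.map R) (by simp)
  have hlim : Tendsto R U (𝓝 Q) := hQ
  have hint : ∀ g : C(Prob Γ, ℝ), Tendsto (fun n => ∫ μ, g μ ∂(R n : Measure (Prob Γ))) U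
      (𝓝 (∫ μ, g μ ∂(Q : Measure (Prob Γ)))) := fun g =>
    (ProbabilityMeasure.continuous_integral_continuousMap g).continuousAt.tendsto.comp hlim
  refine ⟨Q, ?_, ?_, ?_⟩
  · suffices h : ((step hσ Q : ProbabilityMeasure (Prob Γ)) : Measure (Prob Γ)) = Q from
      Subtype.ext h
    refine ext_of_forall_integral_eq_of_IsFiniteMeasure fun f => ?_
    let g : C(Prob Γ, ℝ) := f.toContinuousMap
    change ∫ μ, g μ ∂_ = ∫ μ, g μ ∂_
    have h1 : Tendsto (fun n => ∫ μ, g μ ∂(step hσ (R n) : Measure (Prob Γ))) U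
        (𝓝 (∫ μ, g μ ∂(step hσ Q : Measure (Prob Γ)))) :=
      ((ProbabilityMeasure.continuous_integral_continuousMap g).comp
        (continuous_step hσ)).continuousAt.tendsto.comp hlim
    -- Applying `step` shifts the average by one time unit, so only the two end terms survive,
    -- divided by n + 1.
    have h2 : ∀ n, ∫ μ, g μ ∂(step hσ (R n) : Measure (Prob Γ)) -
        ∫ μ, g μ ∂(R n : Measure (Prob Γ)) = ((n + 1 : ℕ) : ℝ)⁻¹ *
          (∫ μ, g μ ∂((step hσ)^[n + 1] (δ n) : Measure (Prob Γ)) -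
            ∫ μ, g μ ∂(δ n : Measure (Prob Γ))) := by
      intro n
      have h3 := integral_average (fun k => (step hσ)^[k] (δ n)) n
        ⟨_, continuous_transition hσ g⟩
      have h4 := integral_average (fun k => (step hσ)^[k] (δ n)) n g
      simp only [ContinuousMap.coe_mk] at h3
      simp_rw [← integral_step] at h3
      rw [h3, h4, ← mul_sub, ← Finset.sum_sub_distrib]
      congr 1
      have := Finset.sum_range_sub
        (fun k => ∫ μ, g μ ∂((step hσ)^[k] (δ n) : Measure (Prob Γ))) (n + 1)
      simpa only [Function.iterate_succ_apply', Function.iterate_zero, id] using this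
    have h5 : Tendsto (fun n => ∫ μ, g μ ∂(step hσ (R n) : Measure (Prob Γ)) -
        ∫ μ, g μ ∂(R n : Measure (Prob Γ))) U (𝓝 0) := by
      refine Tendsto.mono_left ?_ hU
      simp_rw [h2]
      refine Tendsto.zero_mul_isBoundedUnder_le ?_ (isBoundedUnder_of ⟨‖g‖ + ‖g‖, fun n => ?_⟩)
      · exact (tendsto_inv_atTop_nhds_zero_nat (𝕜 := ℝ)).comp (tendsto_add_atTop_nat 1)
      · exact (abs_sub _ _).trans (add_le_add (abs_integral_le_norm _ g) (abs_integral_le_norm _ g))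
    exact sub_eq_zero.1 (tendsto_nhds_unique (h1.sub (hint g)) h5)
  · refine (isClosed_setOf_ae_mem isClosed_microProb).mem_of_tendsto hlim
      (Eventually.of_forall fun n => ?_)
    have hk : ∀ k, ∀ᵐ ν ∂((step hσ)^[k] (δ n) : Measure (Prob Γ)), ν ∈ microProb Γ A := by
      intro k
      induction k with
      | zero =>
        change ∀ᵐ ν ∂(Measure.dirac (μ (n + 1))), ν ∈ microProb Γ A
        rw [ae_dirac_eq]
        exact hμK (n + 1)
      | succ k ih =>
        rw [Function.iterate_succ_apply']
        exact ae_mem_microProb_step hσ ih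
    change ∀ᵐ ν ∂(R n : Measure (Prob Γ)), ν ∈ microProb Γ A
    rw [coe_average]
    refine Measure.ae_smul_measure ?_ _
    rw [ae_finsetSum_measure_iff]
    exact fun k _ => hk k
  -- The entropy of the average is known exactly: at level n + 1 the information is almost surely
  -- the constant log N_{n+1}(A).
  · have h1 : ∀ n, ∫ μ, entropyOne Γ μ ∂(R n : Measure (Prob Γ)) =
        1 / ((n + 1 : ℕ) : ℝ) * Real.log (maxCount Γ A (n + 1)) := by
      intro n
      rw [integral_average, sum_integral_entropyOne_step]
      change _ * ∫ ν, _ ∂(Measure.dirac (μ (n + 1))) = _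
      rw [integral_dirac, one_div]
      congr 1
      rw [integral_congr_ae (g := fun _ => Real.log (maxCount Γ A (n + 1)))]
      · simp
      · filter_upwards [hμ (n + 1)] with x hx
        rw [hx, Real.log_inv, neg_neg]
    refine tendsto_nhds_unique (hint (entropyOne Γ)) ?_
    simp_rw [h1]
    exact (hL.comp (tendsto_add_atTop_nat 1)).mono_left hU

end MicroMeasures

/-! ### Extreme maximisers on compact sets of distributions -/

section Extreme

/-- On a compact set of probability measures, a continuous affine functional attains its maximum
at a point that is not a proper convex combination of two elements of the set. -/
theorem exists_extreme_maximizer {X : Type*} [TopologicalSpace X] [CompactSpace X]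
    [TopologicalSpace.MetrizableSpace X] [MeasurableSpace X] [BorelSpace X]
    {S : Set (ProbabilityMeasure X)} (hS : IsClosed S) (hne : S.Nonempty) (h : C(X, ℝ)) :
    ∃ Q ∈ S, (∀ R ∈ S, ∫ x, h x ∂(R : Measure X) ≤ ∫ x, h x ∂(Q : Measure X)) ∧
      ∀ Q₁ ∈ S, ∀ Q₂ ∈ S, ∀ a b : ℝ≥0, 0 < a → 0 < b → a + b = 1 →
        (Q : Measure X) = a • (Q₁ : Measure X) + b • (Q₂ : Measure X) → Q₁ = Q₂ := by
  -- Integration against all continuous functions embeds the probability measures in a locally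
  -- convex space, where compact nonempty sets have extreme points.
  let J : ProbabilityMeasure X → C(X, ℝ) → ℝ := fun Q f => ∫ x, f x ∂(Q : Measure X)
  have hJ : Continuous J := continuous_pi fun f =>
    ProbabilityMeasure.continuous_integral_continuousMap f
  have hJi : Function.Injective J := by
    intro Q R hQR
    suffices e : (Q : Measure X) = R from Subtype.ext e
    exact ext_of_forall_integral_eq_of_IsFiniteMeasure fun f => congrFun hQR f.toContinuousMap
  have hJh : Continuous fun Q => J Q h := (continuous_apply h).comp hJ
  obtain ⟨P, hP, hmax⟩ := hS.isCompact.exists_isMaxOn hne hJh.continuousOn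
  let F : Set (ProbabilityMeasure X) := S ∩ {Q | J Q h = J P h}
  have hF : IsCompact F := (hS.inter (isClosed_eq hJh continuous_const)).isCompact
  obtain ⟨_, ⟨Q, hQ, rfl⟩, hext⟩ :=
    (hF.image hJ).extremePoints_nonempty ⟨J P, P, ⟨hP, rfl⟩, rfl⟩
  have hQh : J Q h = J P h := hQ.2
  refine ⟨Q, hQ.1, fun R hR => ?_, fun Q₁ h₁ Q₂ h₂ a b ha hb hab hQ' => ?_⟩
  · change J R h ≤ J Q h
    rw [hQh]
    exact hmax hR
  have hi : ∀ (R : ProbabilityMeasure X) (f : C(X, ℝ)), Integrable f (R : Measure X) :=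
    fun R f => Integrable.of_bound f.continuous.measurable.aestronglyMeasurable ‖f‖
      (Eventually.of_forall fun p => f.norm_coe_le_norm _)
  have hlin : ∀ f, J Q f = a * J Q₁ f + b * J Q₂ f := by
    intro f
    simp only [J]
    rw [hQ', integral_add_measure ((hi Q₁ f).smul_measure_nnreal) ((hi Q₂ f).smul_measure_nnreal),
      integral_smul_nnreal_measure, integral_smul_nnreal_measure]
    rfl
  have ha' : (0 : ℝ) < a := ha
  have hb' : (0 : ℝ) < b := hb
  have hab' : (a : ℝ) + b = 1 := by exact_mod_cast hab
  have m₁ : J Q₁ h ≤ J P h := hmax h₁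
  have m₂ : J Q₂ h ≤ J P h := hmax h₂
  have hc := hlin h
  rw [hQh] at hc
  have hP1 : (a + b) * J P h = J P h := by rw [hab', one_mul]
  -- A proper average of two values that do not exceed the maximum equals it only if both do. So Q₁
  -- and Q₂ lie in the set F of maximisers, where Q is extreme.
  have e₁ : J Q₁ h = J P h := by
    refine le_antisymm m₁ (le_of_mul_le_mul_left ?_ ha')
    linarith [mul_le_mul_of_nonneg_left m₂ hb'.le]
  have e₂ : J Q₂ h = J P h := by
    refine le_antisymm m₂ (le_of_mul_le_mul_left ?_ hb')
    linarith [mul_le_mul_of_nonneg_left m₁ ha'.le]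
  have hseg : J Q ∈ openSegment ℝ (J Q₁) (J Q₂) :=
    ⟨a, b, ha', hb', hab', funext fun f => (hlin f).symm⟩
  have k₁ := hext ⟨Q₁, ⟨h₁, e₁⟩, rfl⟩ ⟨Q₂, ⟨h₂, e₂⟩, rfl⟩ hseg
  have k₂ := hext ⟨Q₂, ⟨h₂, e₂⟩, rfl⟩ ⟨Q₁, ⟨h₁, e₁⟩, rfl⟩ (openSegment_symm ℝ (J Q₁) _ ▸ hseg)
  exact hJi (k₁.trans k₂.symm)

end Extreme

/-! ### Extremality implies ergodicity, and ergodicity gives entropy -/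

section Ergodic

variable {κ : ℕ} {Γ A : Set (Shift κ)}

theorem measurableSet_pref_mem (S : Set (Word κ)) (n : ℕ) :
    MeasurableSet {x : Γ | pref x.1 n ∈ S} := by
  let _ : MeasurableSpace (Word κ) := ⊤
  exact measurable_comp_pref (Γ := Γ) id n (MeasurableSpace.measurableSet_top (s := S))

theorem tsum_measure_pref_inter (μ : Measure Γ) {Z : Set Γ} (n : ℕ) :
    ∑' w : Word κ, μ ({x | pref x.1 n = w} ∩ Z) = μ Z := by
  have h := lintegral_eq_tsum_pref (μ.restrict Z) n fun _ => 1
  simp only [lintegral_one, Measure.restrict_apply MeasurableSet.univ, univ_inter] at h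
  rw [h]
  refine tsum_congr fun w => ?_
  exact (Measure.restrict_apply (measurableSet_pref_mem {w} n)).symm

/-- Every Borel set is approximated by unions of `n`-cylinders. -/
theorem eventually_exists_pref_approx (μ : Prob Γ) {E : Set Γ} (hE : MeasurableSet E)
    {ε : ℝ≥0∞} (hε : ε ≠ 0) : ∀ᶠ n in atTop, ∃ S : Set (Word κ),
      (μ : Measure Γ) (E \ {x | pref x.1 n ∈ S}) ≤ ε ∧
        (μ : Measure Γ) ({x | pref x.1 n ∈ S} \ E) ≤ ε := by
  obtain ⟨K, hKE, hK, hμK⟩ := hE.exists_isClosed_sdiff_lt (measure_ne_top (μ : Measure Γ) E) hε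
  -- The n-cylinders that meet the closed set K have unions decreasing to K.
  let S : ℕ → Set (Word κ) := fun n => (fun y : Γ => pref y.1 n) '' K
  let C : ℕ → Set Γ := fun n => {x | pref x.1 n ∈ S n}
  have hKC : ∀ n, K ⊆ C n := fun n x hx => ⟨x, hx, rfl⟩
  have hanti : Antitone fun n => C n \ K := by
    rintro m n hmn x ⟨⟨y, hy, hyx⟩, hx⟩
    refine ⟨⟨y, hy, ?_⟩, hx⟩
    change pref y.1 m = pref x.1 m
    rw [← pref_take y.1 hmn, ← pref_take x.1 hmn]
    exact congrArg _ hyx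
  have hempty : ⋂ n, C n \ K = ∅ := by
    rw [eq_empty_iff_forall_notMem]
    intro x hx
    rw [mem_iInter] at hx
    refine (hx 0).2 ?_
    have hb : (𝓝 x).HasBasis (fun _ : ℕ => True) fun n => cylIn Γ (pref x.1 n) := by
      rw [nhds_subtype_eq_comap]
      exact (hasBasis_nhds_cyl x.1).comap _
    rw [← hK.closure_eq, mem_closure_iff_nhds_basis hb]
    intro n _
    obtain ⟨y, hy, hyx⟩ := (hx n).1
    exact ⟨y, hy, mem_cyl_pref.2 hyx⟩
  have hlim := tendsto_measure_iInter_atTop (μ := (μ : Measure Γ)) (s := fun n => C n \ K)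
    (fun n => ((measurableSet_pref_mem (S n) n).diff hK.measurableSet).nullMeasurableSet) hanti
    ⟨0, measure_ne_top _ _⟩
  rw [hempty, measure_empty] at hlim
  filter_upwards [hlim.eventually_le_const (pos_iff_ne_zero.2 hε)] with n hn
  exact ⟨S n, (measure_mono (sdiff_subset_sdiff_right (hKC n))).trans hμK.le,
    (measure_mono (sdiff_subset_sdiff_right hKE)).trans hn⟩

/-- Let C be a union of n-cylinders approximating E. A cylinder in C contributes at most its mass
outside E, any other at most its mass in E, so the sum is at most the mass of the symmetric
difference. -/
theorem tendsto_tsum_min_measure (μ : Prob Γ) {E : Set Γ} (hE : MeasurableSet E) :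
    Tendsto (fun n => ∑' w : Word κ, min ((μ : Measure Γ) ({x | pref x.1 n = w} ∩ E))
      ((μ : Measure Γ) ({x | pref x.1 n = w} ∩ Eᶜ))) atTop (𝓝 0) := by
  rw [ENNReal.tendsto_nhds_zero]
  intro ε hε
  filter_upwards [eventually_exists_pref_approx μ hE (ENNReal.half_pos hε.ne').ne'] with n hn
  obtain ⟨S, h1, h2⟩ := hn
  set C := {x : Γ | pref x.1 n ∈ S} with hC
  calc _ ≤ ∑' w : Word κ, (μ : Measure Γ) ({x | pref x.1 n = w} ∩ (E \ C ∪ C \ E)) := by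
        refine ENNReal.tsum_le_tsum fun w => ?_
        by_cases hw : w ∈ S
        · refine (min_le_right _ _).trans (measure_mono ?_)
          rintro x ⟨hx, hxE⟩
          exact ⟨hx, Or.inr ⟨by rw [hC, mem_ofPred_eq, show pref x.1 n = w from hx]; exact hw, hxE⟩⟩
        · refine (min_le_left _ _).trans (measure_mono ?_)
          rintro x ⟨hx, hxE⟩
          refine ⟨hx, Or.inl ⟨hxE, fun hxC => hw ?_⟩⟩
          rwa [hC, mem_ofPred_eq, show pref x.1 n = w from hx] at hxC
    _ = (μ : Measure Γ) (E \ C ∪ C \ E) := tsum_measure_pref_inter _ n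
    _ ≤ ε / 2 + ε / 2 := (measure_union_le _ _).trans (add_le_add h1 h2)
    _ = ε := ENNReal.add_halves ε

theorem mem_iff_cpMap_iterate_mem (hσ : MapsTo shift Γ Γ) {B : Set (ProbPt Γ)}
    (hinv : cpMap hσ ⁻¹' B = B) (n : ℕ) (p : ProbPt Γ) : (cpMap hσ)^[n] p ∈ B ↔ p ∈ B := by
  have h : (cpMap hσ)^[n] ⁻¹' B = B := Function.IsFixedPt.preimage_iterate hinv n
  exact Set.ext_iff.1 h p

/-- Almost everywhere on [w], invariance makes (μ, x) ∈ B equivalent to (μ_w, σ^{|w|}(x)) ∈ B. -/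
theorem measure_mul_condWord_section (hσ : MapsTo shift Γ Γ) {B : Set (ProbPt Γ)}
    (hB : MeasurableSet B) (hinv : cpMap hσ ⁻¹' B = B) (μ : Prob Γ) (w : Word κ) :
    (μ : Measure Γ) (cylIn Γ w) * (condWord hσ μ w : Measure Γ) {y | (condWord hσ μ w, y) ∈ B} =
      (μ : Measure Γ) (cylIn Γ w ∩ {x | (μ, x) ∈ B}) := by
  have hBw : MeasurableSet {y | (condWord hσ μ w, y) ∈ B} := measurable_prodMk_left hB
  have hBμ : MeasurableSet {x | (μ, x) ∈ B} := measurable_prodMk_left hB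
  have h := setLIntegral_cylIn hσ μ w (measurable_one.indicator hBw)
  rw [lintegral_indicator_one hBw] at h
  rw [← h, inter_comm, ← Measure.restrict_apply hBμ, ← lintegral_indicator_one hBμ]
  refine lintegral_congr_ae ?_
  filter_upwards [ae_restrict_of_ae (ae_mem_omega μ),
    ae_restrict_mem (measurableSet_cylIn Γ w)] with x hx hxw
  have e : (cpMap hσ)^[w.length] (μ, x) = (condWord hσ μ w, (shiftIn hσ)^[w.length] x) := by
    rw [cpMap_iterate hσ hx, show pref x.1 w.length = w from hxw]
  have h2 := mem_iff_cpMap_iterate_mem hσ hinv w.length (μ, x)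
  rw [e] at h2
  change indicator {y | (condWord hσ μ w, y) ∈ B} 1 ((shiftIn hσ)^[w.length] x) =
    indicator {x | (μ, x) ∈ B} 1 x
  classical
  simp only [indicator_apply, mem_ofPred_eq, h2]
  rfl

/-- For an invariant set `B`, the fibres of `B` are almost surely trivial. -/
theorem ae_section_null_or_conull (hσ : MapsTo shift Γ Γ) {Q : ProbabilityMeasure (Prob Γ)}
    (hQ : step hσ Q = Q) {B : Set (ProbPt Γ)} (hB : MeasurableSet B)
    (hinv : cpMap hσ ⁻¹' B = B) : ∀ᵐ μ : Prob Γ ∂(Q : Measure (Prob Γ)),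
      (μ : Measure Γ) {x | (μ, x) ∈ B} = 0 ∨ (μ : Measure Γ) {x | (μ, x) ∈ Bᶜ} = 0 := by
  have hsec : ∀ {C : Set (ProbPt Γ)}, MeasurableSet C →
      Measurable fun μ : Prob Γ => (μ : Measure Γ) {x | (μ, x) ∈ C} := fun hC =>
    ProbabilityTheory.Kernel.measurable_kernel_prodMk_left (κ := ker Γ) hC
  -- φ measures how far the fibre of B is from trivial. By stationarity its mean along M^n does not
  -- depend on n. By conditioning on n-cylinders, that mean is the integral of the sums in
  -- `tendsto_tsum_min_measure`, hence tends to 0.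
  let φ : Prob Γ → ℝ≥0∞ := fun μ =>
    min ((μ : Measure Γ) {x | (μ, x) ∈ B}) ((μ : Measure Γ) {x | (μ, x) ∈ Bᶜ})
  have hφ : Measurable φ := (hsec hB).min (hsec hB.compl)
  have hinv' : cpMap hσ ⁻¹' Bᶜ = Bᶜ := by rw [preimage_compl, hinv]
  have hM : ∀ n, Measurable fun p : ProbPt Γ => φ ((cpMap hσ)^[n] p).1 := fun n =>
    hφ.comp ((measurable_cpMap hσ).iterate n).fst
  let I : ℕ → Prob Γ → ℝ≥0∞ := fun n μ => ∫⁻ x, φ ((cpMap hσ)^[n] (μ, x)).1 ∂(μ : Measure Γ)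
  have hI : ∀ n, ∫⁻ μ, I n μ ∂(Q : Measure (Prob Γ)) = ∫⁻ μ, φ μ ∂(Q : Measure (Prob Γ)) := by
    intro n
    have h1 := ((measurePreserving_lift hσ hQ).iterate n).map_eq
    calc _ = ∫⁻ p, φ ((cpMap hσ)^[n] p).1 ∂(lift Q : Measure (ProbPt Γ)) :=
          (lintegral_lift Q (hM n)).symm
      _ = ∫⁻ p, φ p.1 ∂(lift Q : Measure (ProbPt Γ)) := by
          conv_rhs => rw [← h1]
          rw [lintegral_map (f := fun p : ProbPt Γ => φ p.1) (hφ.comp measurable_fst) ((measurable_cpMap hσ).iterate n)]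
      _ = ∫⁻ μ, φ μ ∂(Q : Measure (Prob Γ)) := by
          rw [← lintegral_map hφ measurable_fst, fst_lift]
  have hIeq : ∀ n μ, I n μ = ∑' w : Word κ,
      min ((μ : Measure Γ) ({x | pref x.1 n = w} ∩ {x | (μ, x) ∈ B}))
        ((μ : Measure Γ) ({x | pref x.1 n = w} ∩ {x | (μ, x) ∈ B}ᶜ)) := by
    intro n μ
    have h1 : I n μ = ∫⁻ x, φ (condWord hσ μ (pref x.1 n)) ∂(μ : Measure Γ) := by
      refine lintegral_congr_ae ?_
      filter_upwards [ae_mem_omega μ] with x hx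
      rw [cpMap_iterate hσ hx]
    rw [h1, lintegral_eq_tsum_pref _ n]
    refine tsum_congr fun w => ?_
    rcases setOf_pref_eq (Γ := Γ) w n with ⟨h, rfl⟩ | h
    · rw [h]
      have h2 : ∫⁻ x in cylIn Γ w, φ (condWord hσ μ (pref x.1 w.length)) ∂(μ : Measure Γ) =
          ∫⁻ x in cylIn Γ w, φ (condWord hσ μ w) ∂(μ : Measure Γ) :=
        setLIntegral_congr_fun (measurableSet_cylIn Γ w) fun x hx => by
          simp only [show pref x.1 w.length = w from hx]
      rw [h2, setLIntegral_const, mul_comm, mul_min,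
        measure_mul_condWord_section hσ hB hinv, measure_mul_condWord_section hσ hB.compl hinv']
      rfl
    · rw [h]
      simp
  have hlim : Tendsto (fun n => ∫⁻ μ, I n μ ∂(Q : Measure (Prob Γ))) atTop
      (𝓝 (∫⁻ _, 0 ∂(Q : Measure (Prob Γ)))) := by
    refine tendsto_lintegral_of_dominated_convergence (fun _ => 1) (fun n => ?_) (fun n => ?_)
      (by simp) ?_
    · exact Measurable.lintegral_kernel_prod_right' (κ := ker Γ) (hM n)
    · refine Eventually.of_forall fun μ => ?_
      calc I n μ ≤ ∫⁻ _, 1 ∂(μ : Measure Γ) :=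
            lintegral_mono fun x => (min_le_left _ _).trans prob_le_one
        _ = 1 := by simp
    · refine Eventually.of_forall fun μ => ?_
      simp_rw [hIeq]
      exact tendsto_tsum_min_measure μ (measurable_prodMk_left hB)
  simp_rw [hI, lintegral_zero] at hlim
  have h0 : ∫⁻ μ, φ μ ∂(Q : Measure (Prob Γ)) = 0 :=
    tendsto_nhds_unique tendsto_const_nhds hlim
  rw [lintegral_eq_zero_iff hφ] at h0
  filter_upwards [h0] with μ hμ
  have hμ' : min ((μ : Measure Γ) {x | (μ, x) ∈ B}) ((μ : Measure Γ) {x | (μ, x) ∈ Bᶜ}) = 0 := hμ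
  rcases min_choice ((μ : Measure Γ) {x | (μ, x) ∈ B}) ((μ : Measure Γ) {x | (μ, x) ∈ Bᶜ})
    with h | h
  · exact Or.inl (h ▸ hμ')
  · exact Or.inr (h ▸ hμ')

/-- The distribution `Q` conditioned on `D`. -/
def condProb (Q : ProbabilityMeasure (Prob Γ)) (D : Set (Prob Γ))
    (h : (Q : Measure (Prob Γ)) D ≠ 0) : ProbabilityMeasure (Prob Γ) :=
  ⟨ProbabilityTheory.cond (Q : Measure (Prob Γ)) D, ProbabilityTheory.cond_isProbabilityMeasure h⟩

theorem coe_condProb (Q : ProbabilityMeasure (Prob Γ)) (D : Set (Prob Γ))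
    (h : (Q : Measure (Prob Γ)) D ≠ 0) : (condProb Q D h : Measure (Prob Γ)) =
      ((Q : Measure (Prob Γ)) D)⁻¹ • (Q : Measure (Prob Γ)).restrict D := rfl

/-- Up to normalisation, lifting Q conditioned on D restricts `lift Q` to the invariant set B, and M
preserves that restriction. -/
theorem step_condProb (hσ : MapsTo shift Γ Γ) {Q : ProbabilityMeasure (Prob Γ)}
    (hQ : step hσ Q = Q) {B : Set (ProbPt Γ)} (hB : MeasurableSet B)
    (hinv : cpMap hσ ⁻¹' B = B) {D : Set (Prob Γ)} (hD : MeasurableSet D)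
    (hBD : B =ᵐ[(lift Q : Measure (ProbPt Γ))] Prod.fst ⁻¹' D)
    (h : (Q : Measure (Prob Γ)) D ≠ 0) : step hσ (condProb Q D h) = condProb Q D h := by
  have e : (lift (condProb Q D h) : Measure (ProbPt Γ)) =
      ((Q : Measure (Prob Γ)) D)⁻¹ • (lift Q : Measure (ProbPt Γ)).restrict B := by
    rw [Measure.restrict_congr_set hBD, coe_lift, coe_condProb, Measure.compProd_smul_left]
    congr 1
    ext s hs
    rw [Measure.compProd_apply hs, Measure.restrict_apply hs, coe_lift,
      Measure.compProd_apply (hs.inter (measurable_fst hD)), ← lintegral_indicator hD]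
    refine lintegral_congr fun μ => ?_
    by_cases hμ : μ ∈ D
    · rw [indicator_of_mem hμ]
      congr 1
      ext x
      simp [hμ]
    · rw [indicator_of_notMem hμ]
      symm
      convert! measure_empty (μ := ker Γ μ)
      ext x
      simp [hμ]
  refine step_eq_of_map_eq hσ ?_
  have hr := ((measurePreserving_lift hσ hQ).restrict_preimage hB).map_eq
  rw [hinv] at hr
  rw [e, Measure.map_smul, hr]

/-- Trivial fibres make an invariant B equal to D × Γ modulo null sets. If B were neither null nor
conull, Q would be a proper convex combination of its conditionings on D and Dᶜ. These are
stationary, carried by K, and distinct because only one of them charges D. -/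
theorem ergodic_lift (hσ : MapsTo shift Γ Γ) {K : Set (Prob Γ)}
    {Q : ProbabilityMeasure (Prob Γ)} (hQ : step hσ Q = Q)
    (hK : ∀ᵐ μ ∂(Q : Measure (Prob Γ)), μ ∈ K)
    (hext : ∀ Q₁ ∈ {R : ProbabilityMeasure (Prob Γ) | step hσ R = R ∧
        ∀ᵐ μ ∂(R : Measure (Prob Γ)), μ ∈ K},
      ∀ Q₂ ∈ {R : ProbabilityMeasure (Prob Γ) | step hσ R = R ∧
        ∀ᵐ μ ∂(R : Measure (Prob Γ)), μ ∈ K}, ∀ a b : ℝ≥0, 0 < a → 0 < b → a + b = 1 →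
        (Q : Measure (Prob Γ)) = a • (Q₁ : Measure (Prob Γ)) + b • (Q₂ : Measure (Prob Γ)) →
        Q₁ = Q₂) :
    Ergodic (cpMap hσ) (lift Q : Measure (ProbPt Γ)) := by
  refine ⟨measurePreserving_lift hσ hQ, ⟨fun B hB hinv => ?_⟩⟩
  let D : Set (Prob Γ) := {μ | (μ : Measure Γ) {x | (μ, x) ∈ Bᶜ} = 0}
  have hD : MeasurableSet D :=
    (ProbabilityTheory.Kernel.measurable_kernel_prodMk_left (κ := ker Γ) hB.compl)
      (measurableSet_singleton 0)
  have hBD : B =ᵐ[(lift Q : Measure (ProbPt Γ))] Prod.fst ⁻¹' D := by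
    have hms : MeasurableSet {p : ProbPt Γ | p ∈ B ↔ p.1 ∈ D} :=
      hB.iff (measurable_fst hD)
    have : ∀ᵐ p ∂(lift Q : Measure (ProbPt Γ)), p ∈ B ↔ p.1 ∈ D := by
      rw [coe_lift]
      refine Measure.ae_compProd_of_ae_ae hms ?_
      filter_upwards [ae_section_null_or_conull hσ hQ hB hinv] with μ hμ
      rw [ker_apply]
      by_cases hμD : μ ∈ D
      · have h1 : ∀ᵐ x ∂(μ : Measure Γ), (μ, x) ∈ B := by
          have h2 : (μ : Measure Γ) {x | (μ, x) ∈ Bᶜ} = 0 := hμD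
          exact h2
        filter_upwards [h1] with x hx
        simp [hx, hμD]
      · have h1 : ∀ᵐ x ∂(μ : Measure Γ), (μ, x) ∉ B := by
          rcases hμ with h | h
          · exact measure_eq_zero_iff_ae_notMem.1 h
          · exact absurd h hμD
        filter_upwards [h1] with x hx
        simp [hx, hμD]
    filter_upwards [this] with p hp
    exact propext hp
  rw [eventuallyConst_set']
  by_contra! hcon
  have hfst : ∀ {S : Set (Prob Γ)}, MeasurableSet S → (Q : Measure (Prob Γ)) S =
      (lift Q : Measure (ProbPt Γ)) (Prod.fst ⁻¹' S) := fun hS => by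
    rw [← Measure.map_apply measurable_fst hS, fst_lift]
  have h1 : (Q : Measure (Prob Γ)) D ≠ 0 := by
    rw [hfst hD, ← measure_congr hBD]
    exact fun h => hcon.1 (ae_eq_empty.2 h)
  have h2 : (Q : Measure (Prob Γ)) Dᶜ ≠ 0 := by
    rw [hfst hD.compl, preimage_compl, ← measure_congr hBD.compl]
    exact fun h => hcon.2 (ae_eq_univ.2 h)
  have hKr : ∀ {S : Set (Prob Γ)} (hS : (Q : Measure (Prob Γ)) S ≠ 0),
      ∀ᵐ μ ∂(condProb Q S hS : Measure (Prob Γ)), μ ∈ K := fun hS =>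
    Measure.ae_smul_measure (ae_restrict_of_ae hK) _
  have hinv' : cpMap hσ ⁻¹' Bᶜ = Bᶜ := by rw [preimage_compl, hinv]
  have key := hext (condProb Q D h1) ⟨step_condProb hσ hQ hB hinv hD hBD h1, hKr h1⟩
    (condProb Q Dᶜ h2) ⟨step_condProb hσ hQ hB.compl hinv' hD.compl hBD.compl h2, hKr h2⟩
    (Q D) (Q Dᶜ) ?_ ?_ ?_ ?_
  · have e1 : (condProb Q D h1 : Measure (Prob Γ)) D = 1 :=
      ProbabilityTheory.cond_apply_self h1 (measure_ne_top _ _)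
    rw [key, coe_condProb, Measure.smul_apply, Measure.restrict_apply hD, inter_compl_self,
      measure_empty] at e1
    simp at e1
  · rw [pos_iff_ne_zero]
    exact fun h => h1 (by simpa using congrArg (fun r : ℝ≥0 => (r : ℝ≥0∞)) h)
  · rw [pos_iff_ne_zero]
    exact fun h => h2 (by simpa using congrArg (fun r : ℝ≥0 => (r : ℝ≥0∞)) h)
  · have := prob_add_prob_compl (μ := (Q : Measure (Prob Γ))) hD
    rw [← ProbabilityMeasure.ennreal_coeFn_eq_coeFn_toMeasure,
      ← ProbabilityMeasure.ennreal_coeFn_eq_coeFn_toMeasure] at this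
    exact_mod_cast this
  · have e : ∀ {S : Set (Prob Γ)} (hS : (Q : Measure (Prob Γ)) S ≠ 0),
        (Q S : ℝ≥0) • (condProb Q S hS : Measure (Prob Γ)) =
          (Q : Measure (Prob Γ)).restrict S := by
      intro S hS
      rw [coe_condProb, ← ProbabilityMeasure.ennreal_coeFn_eq_coeFn_toMeasure] at *
      rw [ENNReal.smul_def, smul_smul, ENNReal.mul_inv_cancel hS (by simp), one_smul]
    rw [e h1, e h2, Measure.restrict_add_restrict_compl hD]

theorem isClosed_stationary [CompactSpace Γ] (hσ : MapsTo shift Γ Γ) {K : Set (Prob Γ)}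
    (hK : IsClosed K) : IsClosed {R : ProbabilityMeasure (Prob Γ) | step hσ R = R ∧
      ∀ᵐ μ ∂(R : Measure (Prob Γ)), μ ∈ K} :=
  (isClosed_eq (continuous_step hσ) continuous_id).inter (isClosed_setOf_ae_mem hK)

theorem ae_hasEntropy [CompactSpace Γ] (hσ : MapsTo shift Γ Γ)
    {Q : ProbabilityMeasure (Prob Γ)} (hQ : Ergodic (cpMap hσ) (lift Q : Measure (ProbPt Γ))) :
    ∀ᵐ μ ∂(Q : Measure (Prob Γ)),
      HasEntropy μ (∫ μ, entropyOne Γ μ ∂(Q : Measure (Prob Γ))) := by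
  have h := tendsto_birkhoffSum_of_ergodic hQ measurable_info (integrable_info Q)
  rw [integral_info_lift, coe_lift] at h
  filter_upwards [Measure.ae_ae_of_ae_compProd h] with μ hμ
  rw [ker_apply] at hμ
  filter_upwards [hμ, ae_mem_omega μ] with x hx hxo
  refine hx.congr fun n => ?_
  rw [birkhoffSum_info hσ hxo]
  ring

end Ergodic

end CPDist

end

/-! ### The two CP-distributions -/

open CPDist
theorem mainTheorem10 {κ : ℕ} (hκ : 2 ≤ κ) (Γ : Set (Shift κ)) (hΓ : IsCompact Γ)
    (hσ : MapsTo shift Γ Γ) (A : Set (Shift κ)) (hAΓ : A ⊆ Γ) (hA : IsCompact A)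
    (hne : A.Nonempty) :
    ∃ L : ℝ,
      Tendsto (fun n : ℕ => 1 / (n : ℝ) * Real.log (maxCount Γ A n)) atTop (𝓝 L) ∧
      (∃ Q : ProbabilityMeasure (ProbPt Γ),
        IsCP hσ Q ∧
        (∀ᵐ p ∂(Q : Measure (ProbPt Γ)), p ∈ omegaMicro Γ A) ∧
        Integrable info (Q : Measure (ProbPt Γ)) ∧
        ∫ p, info p ∂(Q : Measure (ProbPt Γ)) = L) ∧
      (∃ (Q : ProbabilityMeasure (ProbPt Γ)) (Qb : ProbabilityMeasure (Prob Γ)),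
        IsCP hσ Q ∧ Ergodic (cpMap hσ) (Q : Measure (ProbPt Γ)) ∧ IsAdaptedTo Q Qb ∧
        ∀ᵐ μ ∂(Qb : Measure (Prob Γ)),
          (∃ A', IsMicroset Γ A A' ∧ spt μ ⊆ A') ∧ ∃ h : ℝ, HasEntropy μ h ∧ L ≤ h) := by
  have : CompactSpace Γ := isCompact_iff_compactSpace.1 hΓ
  obtain ⟨L, hL⟩ := exists_tendsto_log_maxCount hσ hAΓ hA hne
  obtain ⟨Q, hQ, hQK, hQL⟩ := exists_stationary hΓ hσ hAΓ hA hne hL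
  refine ⟨L, hL, ⟨lift Q, isCP_lift hσ hQ, ?_, integrable_info Q, ?_⟩, ?_⟩
  · have hms : MeasurableSet (omega Γ ∩ Prod.fst ⁻¹' microProb Γ A) :=
      measurableSet_omega.inter (measurable_fst isClosed_microProb.measurableSet)
    have h : ∀ᵐ p ∂(lift Q : Measure (ProbPt Γ)), p ∈ omega Γ ∩ Prod.fst ⁻¹' microProb Γ A := by
      rw [coe_lift]
      refine Measure.ae_compProd_of_ae_ae hms ?_
      filter_upwards [hQK] with μ hμ
      filter_upwards [ae_mem_omega μ] with x hx
      exact ⟨hx, hμ⟩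
    filter_upwards [h] with p hp
    exact ⟨hp.1, exists_isMicroset_of_mem_microProb hΓ hσ hAΓ hA hp.2⟩
  · rw [integral_info_lift, hQL]
  -- The entropy of almost every μ will be the maximal value of the functional, which is at least
  -- its value L at Q.
  · obtain ⟨R, ⟨hR, hRK⟩, hmax, hext⟩ := exists_extreme_maximizer
      (isClosed_stationary hσ (isClosed_microProb (A := A))) ⟨Q, hQ, hQK⟩ (entropyOne Γ)
    have herg := ergodic_lift hσ hR hRK hext
    refine ⟨lift R, R, isCP_lift hσ hR, herg, isAdaptedTo_lift R, ?_⟩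
    filter_upwards [hRK, ae_hasEntropy hσ herg] with μ hμ hμ'
    exact ⟨exists_isMicroset_of_mem_microProb hΓ hσ hAΓ hA hμ, _, hμ',
      hQL ▸ hmax Q ⟨hQ, hQK⟩⟩
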